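/- Let $d\ge 1$, let $D\subset\mathbb R^d$ be a bounded open set, let $V=H^1_0(D)$ (the closure of $C_c^\infty(D)$ in $H^1(D)$) with norm $\|v\|_V=\|\nabla v\|_{L^2(D)}$, let $f\in V'=H^{-1}(D)$, and let $(\psi_j)_{j\ge1}$ be an arbitrary sequence of functions in $L^\infty(D)$ (no condition on their supports). Let $\gamma$ be the countable product of standard Gaussian measures on $U=\mathbb R^{\mathbb N}$. For $y\in U$ for which the series $b(y)=\sum_{j\ge1}y_j\psi_j$ converges in $L^\infty(D)$, let $u(y)\in V$ be the weak solution of $-\mathrm{div}(e^{b(y)}\nabla u(y))=f$, that is, $\int_D e^{b(y)}\nabla u(y)\cdot\nabla v\,dx=f(v)$ for all $v\in V$ (put $u(y)=0$ for the other $y$). Let $\mathcal F$ be the set of finitely supported sequences $\nu=(\nu_j)_{j\ge1}$ of nonnegative integers and, for $\nu\in\mathcal F$, let $H_\nu(y)=\prod_{j}H_{\nu_j}(y_j)$, where $H_k$ is the Hermite polynomial of degree $k$ normalized in $L^2$ of the standard Gaussian measure, and $u_\nu=\int_U u(y)H_\nu(y)\,d\gamma(y)\in V$. Let $0<p<2$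 and let $q$ be defined by $\frac1q=\frac1p+\frac12$. (1) Suppose that $(\|\psi_j\|_{L^\infty})_{j\ge1}\in\ell^q(\mathbb N)$. Then for $\gamma$-almost every $y$ the series $b(y)$ converges in $L^\infty(D)$ and the weak solution $u(y)$ exists and is unique; the map $u$ belongs to $L^2(U,V,\gamma)$; and $(\|u_\nu\|_V)_{\nu\in\mathcal F}\in\ell^p(\mathcal F)$. In particular, best $n$-term Hermite approximations converge in $L^2(U,V,\gamma)$ with rate $n^{-s}$, $s=\frac1q-1=\frac1p-\frac12$: for every $n\ge0$ there is a set $\Lambda_n\subset\mathcal F$ of indices of $n$ largest $\|u_\nu\|_V$, and every such set satisfies $$\Big\|u-\sum_{\nu\in\Lambda_n}u_\nu H_\nu\Big\|_{L^2(U,V,\gamma)}\le C\,(n+1)^{-s},\qquad C=\Big(\sum_{\nu\in\mathcal F}\|u_\nu\|_V^p\Big)^{1/p}.$$ (2) The hypothesis in (1) holds whenever $(j^\beta\|\psi_j\|_{L^\infty})_{j\ge1}\in\ell^p(\mathbb N)$ for some $\beta>\frac12$; in particular it is implied by $(j\|\psi_j\|_{L^\infty})_{j\ge1}\in\ell^p(\mathbb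 N)$. -/

import Mathlib

open MeasureTheory ProbabilityTheory Filter Topology
open scoped ENNReal ContDiff

noncomputable section

namespace LognormalPDE

/-- Lebesgue measure on `D`. -/
abbrev vol {d : ℕ} (D : Set (EuclideanSpace ℝ (Fin d))) : Measure (EuclideanSpace ℝ (Fin d)) :=
  volume.restrict D

/-- `L^∞(D)`. -/
abbrev LInf {d : ℕ} (D : Set (EuclideanSpace ℝ (Fin d))) : Type :=
  Lp ℝ ∞ (vol D)

/-- The Hilbert space `L²(D) × L²(D; ℝ^d)` of pairs (function, gradient field), with the norm
`(‖v‖² + ‖g‖²)^{1/2}`. -/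
abbrev Pairs {d : ℕ} (D : Set (EuclideanSpace ℝ (Fin d))) : Type :=
  WithLp 2 (Lp ℝ 2 (vol D) × Lp (EuclideanSpace ℝ (Fin d)) 2 (vol D))

/-- The space of all pairs `(φ, ∇φ)` with `φ ∈ C_c^∞(D)`. -/
def testPairs {d : ℕ} (D : Set (EuclideanSpace ℝ (Fin d))) : Submodule ℝ (Pairs D) where
  carrier := {w | ∃ φ : EuclideanSpace ℝ (Fin d) → ℝ,
    ContDiff ℝ ∞ φ ∧ HasCompactSupport φ ∧ tsupport φ ⊆ D ∧
      w.fst =ᵐ[vol D] φ ∧ w.snd =ᵐ[vol D] gradient φ}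
  zero_mem' := by
    refine ⟨0, contDiff_const, HasCompactSupport.zero, by simp, ?_, ?_⟩
    · exact Lp.coeFn_zero _ _ _
    · filter_upwards [Lp.coeFn_zero (EuclideanSpace ℝ (Fin d)) 2 (vol D)] with x hx
      have h0 : gradient (0 : EuclideanSpace ℝ (Fin d) → ℝ) x = 0 :=
        gradient_fun_const x (0 : ℝ)
      rw [h0]
      exact hx
  add_mem' := by
    rintro v w ⟨φ, hφ, hφc, hφs, hv1, hv2⟩ ⟨χ, hχ, hχc, hχs, hw1, hw2⟩
    refine ⟨φ + χ, hφ.add hχ, hφc.add hχc, ?_, ?_, ?_⟩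
    · exact (tsupport_add φ χ).trans (Set.union_subset hφs hχs)
    · exact (Lp.coeFn_add v.fst w.fst).trans (hv1.add hw1)
    · filter_upwards [Lp.coeFn_add v.snd w.snd, hv2, hw2] with x hx h1 h2
      have hg : gradient (φ + χ) x = gradient φ x + gradient χ x := by
        simp only [gradient]
        rw [fderiv_add (hφ.differentiable (by simp) x) (hχ.differentiable (by simp) x), map_add]
      rw [hg, ← h1, ← h2]
      exact hx
  smul_mem' := by
    rintro c w ⟨φ, hφ, hφc, hφs, hw1, hw2⟩
    refine ⟨c • φ, hφ.const_smul c, hφc.smul_left (f := fun _ => c), ?_, ?_, ?_⟩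
    · exact (tsupport_smul_subset_right (fun _ => c) φ).trans hφs
    · exact (Lp.coeFn_smul c w.fst).trans (hw1.const_smul c)
    · filter_upwards [Lp.coeFn_smul c w.snd, hw2] with x hx h1
      have hg : gradient (c • φ) x = c • gradient φ x := by
        simp only [gradient]
        rw [fderiv_const_smul (hφ.differentiable (by simp) x), map_smulₛₗ]
        simp
      rw [hg, ← h1]
      exact hx

/-- `V = H¹₀(D)`: the closure of `C_c^∞(D)` in the `H¹` norm, an element `v` being recorded as the
pair `(v, ∇v)` of the function and its weak gradient.  As a normed space it carries the full `H¹`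
norm; the norm `‖v‖_V = ‖∇v‖_{L²}`, equivalent to it for bounded `D`, is `normV`. -/
abbrev H10 {d : ℕ} (D : Set (EuclideanSpace ℝ (Fin d))) : Type :=
  ↥((testPairs D).topologicalClosure)

/-- The weak gradient of `v ∈ H¹₀(D)`. -/
def grad {d : ℕ} {D : Set (EuclideanSpace ℝ (Fin d))} (v : H10 D) :
    Lp (EuclideanSpace ℝ (Fin d)) 2 (vol D) :=
  (v : Pairs D).snd

/-- `‖v‖_V = ‖∇v‖_{L²(D)}`. -/
def normV {d : ℕ} {D : Set (EuclideanSpace ℝ (Fin d))} (v : H10 D) : ℝ :=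
  ‖grad v‖

/-- `H^{-1}(D)`, the dual of `H¹₀(D)`. -/
abbrev HNeg1 {d : ℕ} (D : Set (EuclideanSpace ℝ (Fin d))) : Type :=
  H10 D →L[ℝ] ℝ

/-- `b = ∑_j y_j ψ_j`, as the limit of the partial sums in `L^∞(D)`. -/
def IsLogCoeff {d : ℕ} {D : Set (EuclideanSpace ℝ (Fin d))} (ψ : ℕ → LInf D) (y : ℕ → ℝ)
    (b : LInf D) : Prop :=
  Tendsto (fun J : ℕ => ∑ j ∈ Finset.range J, y j • ψ j) atTop (𝓝 b)

/-- `w ∈ H¹₀(D)` is a weak solution of `-div(exp(b) ∇w) = f` with homogeneous Dirichlet boundary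
conditions. -/
def IsWeakSolution {d : ℕ} {D : Set (EuclideanSpace ℝ (Fin d))} (b : LInf D) (f : HNeg1 D)
    (w : H10 D) : Prop :=
  ∀ v : H10 D, ∫ x in D, Real.exp (b x) * inner ℝ (grad w x) (grad v x) = f v

open Classical in
/-- The solution map `y ↦ u(y)`; it is set to `0` at those `y` where the series for `b(y)` does not
converge in `L^∞(D)` or there is no weak solution. -/
def solutionMap {d : ℕ} {D : Set (EuclideanSpace ℝ (Fin d))} (ψ : ℕ → LInf D) (f : HNeg1 D)
    (y : ℕ → ℝ) : H10 D :=
  if h : ∃ w : H10 D, ∃ b : LInf D, IsLogCoeff ψ y b ∧ IsWeakSolution b f w then h.choose else 0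

/-- The tensorized standard Gaussian measure on `ℝ^ℕ`. -/
def gaussianMeasure : Measure (ℕ → ℝ) :=
  Measure.infinitePi fun _ : ℕ => gaussianReal 0 1

/-- The univariate Hermite polynomial of degree `k`, orthonormal for the standard Gaussian. -/
def hermite1 (k : ℕ) (t : ℝ) : ℝ :=
  Polynomial.aeval t (Polynomial.hermite k) / Real.sqrt (k.factorial : ℝ)

/-- `H_ν(y) = ∏_j H_{ν_j}(y_j)` for a finitely supported `ν`. -/
def hermiteF (ν : ℕ →₀ ℕ) (y : ℕ → ℝ) : ℝ :=
  ∏ j ∈ ν.support, hermite1 (ν j) (y j)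

/-- The Hermite coefficient `u_ν = ∫ u(y) H_ν(y) dγ(y)`. -/
def hermiteCoeff {d : ℕ} {D : Set (EuclideanSpace ℝ (Fin d))} (u : (ℕ → ℝ) → H10 D)
    (ν : ℕ →₀ ℕ) : H10 D :=
  ∫ y, hermiteF ν y • u y ∂gaussianMeasure

/-- The truncated Hermite series `u_Λ = ∑_{ν ∈ Λ} u_ν H_ν`. -/
def hermiteTrunc {d : ℕ} {D : Set (EuclideanSpace ℝ (Fin d))} (u : (ℕ → ℝ) → H10 D)
    (Λ : Finset (ℕ →₀ ℕ)) (y : ℕ → ℝ) : H10 D :=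
  ∑ ν ∈ Λ, hermiteF ν y • hermiteCoeff u ν

/-- `Λ` consists of the indices of `n` largest `‖u_ν‖_V` (ties broken arbitrarily). -/
def IsNLargest {d : ℕ} {D : Set (EuclideanSpace ℝ (Fin d))} (u : (ℕ → ℝ) → H10 D) (n : ℕ)
    (Λ : Finset (ℕ →₀ ℕ)) : Prop :=
  Λ.card = n ∧ ∀ ν ∈ Λ, ∀ μ ∉ Λ, normV (hermiteCoeff u μ) ≤ normV (hermiteCoeff u ν)

/-- The norm `(∫ ‖w(y)‖_V² dγ(y))^{1/2}` of `L²(U, V, γ)`. -/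
def normL2V {d : ℕ} {D : Set (EuclideanSpace ℝ (Fin d))} (w : (ℕ → ℝ) → H10 D) : ℝ≥0∞ :=
  eLpNorm (fun y => normV (w y)) 2 gaussianMeasure

end LognormalPDE

end

/-!
With `V = H¹₀(D)`, `T` the gradient, `m b` the multiplication by `b` on `L²(D; ℝ^d)` and `F` the
Riesz representative of `f`, the solution is `u(y) = A(b(y))⁻¹ F` for `A(b) = T* exp(m b) T`
(`LogAffineFamily`, `diffusion`; the coercivity of `A(b)` is the Poincaré inequality
`exists_norm_le_norm_grad`). Summability of `‖ψ_j‖` makes `b(y)` converge for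
almost every `y`, `‖b(y)‖` has exponential moments, and `‖u(y)‖ ≤ c⁻² e^{‖b(y)‖} ‖F‖` gives `u ∈ L²`.

The derivatives of `b ↦ A(b)⁻¹ F` are signed sums of words
`A⁻¹ (T* ζ₁ e^{m b} T) A⁻¹ (T* ζ₂ e^{m b} T) ⋯ A⁻¹ F` in products `ζᵢ` of multiplication operators.
In the energy norm `⟪A(b) v, v⟫^{1/2}` each factor `A⁻¹ (T* ζ e^{m b} T)` has norm at most `‖ζ‖`,
whatever `b` is, so that a word is bounded by `∏ ‖ζᵢ‖` times the bound for `A⁻¹ F`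
(`norm_word_le`), and a derivative of order `k` consists of at most `2^k k!` words
(`exists_hasDerivAt_word`).

The Gaussian integration by parts `∫ He_{k+1} φ = ∫ He_k φ'` moves derivatives onto `u`. It is
applied `min(ν_j, r)` times in the coordinate `j`, for a fixed large `r`. With
`μ_j = min(ν_j, r)`, `k = |μ|` and `a_j = ‖ψ_j‖` this gives
`‖u_ν‖ ≤ M 2^k k! ∏_j a_j^{μ_j} ((ν_j - μ_j)! / ν_j!)^{1/2}`
(`norm_integral_hermiteF_smul_solve_le`). The square roots decay like `ν_j^{-r/2}` and make the sum
over `ν` converge. To see that the bound is in `ℓ^p`, write `2 a = c σ` with `c_j = δ a_j^q`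
summable with a small sum and `σ_j = 2 a_j^{1-q} / δ` in `ℓ^e`, `e = 2p/(2-p)`. The factors
`k! ∏ c_j^{μ_j}` are summable because `k! = ∫ e^{-s} s^k ds` turns the sum into an integral of
products (`summable_factorial_mul_prod`), the factors `∏ σ_j^{μ_j}` are in `ℓ^e`, and Young's
inequality combines the two (`exists_summable_coeffBound`).

Finally, the Hermite polynomials are total in `L²(γ; G)` for every Hilbert space `G`
(`ae_eq_zero_of_integral_HeF_eq_zero`), so that the mean square error of a truncated expansion of
`∇u` is `∑_{ν ∉ Λ} ‖u_ν‖²` (`hasSum_norm_sq_hermite_residual`), and Stechkin's estimate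
(`tsum_sq_le_of_largest`) gives the rate.
-/

/-! ### Exponentials of bounded operators -/

namespace LognormalPDE

section OperatorExp

variable {G : Type*} [NormedAddCommGroup G] [InnerProductSpace ℝ G] [CompleteSpace G]

theorem norm_exp_clm_le (x : G →L[ℝ] G) : ‖NormedSpace.exp x‖ ≤ Real.exp ‖x‖ := by
  have h := NormedSpace.exp_series_hasSum_exp' (𝕂 := ℝ) x
  have hs : HasSum (fun n : ℕ => ((n.factorial : ℝ)⁻¹) * ‖x‖ ^ n) (Real.exp ‖x‖) := by
    have := NormedSpace.exp_series_hasSum_exp' (𝕂 := ℝ) ‖x‖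
    rw [← Real.exp_eq_exp_ℝ] at this
    simpa [smul_eq_mul] using this
  rw [← h.tsum_eq]
  refine tsum_of_norm_bounded hs fun n => ?_
  rw [norm_smul, norm_inv, RCLike.norm_natCast]
  gcongr
  rcases n with _ | n
  · simp only [pow_zero]
    exact ContinuousLinearMap.norm_id_le
  · exact norm_pow_le' x n.succ_pos

theorem exp_add_clm {x y : G →L[ℝ] G} (h : Commute x y) :
    NormedSpace.exp (x + y) = NormedSpace.exp x * NormedSpace.exp y :=
  letI : NormedAlgebra ℚ (G →L[ℝ] G) := NormedAlgebra.restrictScalars ℚ ℝ _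
  NormedSpace.exp_add_of_commute h

theorem continuous_exp_clm :
    Continuous (NormedSpace.exp : (G →L[ℝ] G) → (G →L[ℝ] G)) :=
  letI : NormedAlgebra ℚ (G →L[ℝ] G) := NormedAlgebra.restrictScalars ℚ ℝ _
  NormedSpace.exp_continuous

end OperatorExp

/-! ### Log-affine families of coercive operators -/

/-- A family of coercive operators `A(b) = T* exp(m b) T` on a Hilbert space `V`, depending on a
parameter `b` of a normed space `L`.  The model is `V = H¹₀(D)`, `G = L²(D; ℝ^d)`, `L = L^∞(D)`,
with `T` the gradient and `m b` the multiplication by `b`; then `A(b)` is the operator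
`-div(exp(b) ∇ ·)` composed with the Riesz isomorphism. -/
structure LogAffineFamily (V G L : Type*)
    [NormedAddCommGroup V] [InnerProductSpace ℝ V] [CompleteSpace V]
    [NormedAddCommGroup G] [InnerProductSpace ℝ G] [CompleteSpace G]
    [NormedAddCommGroup L] [NormedSpace ℝ L] where
  /-- The gradient. -/
  T : V →L[ℝ] G
  /-- The multiplication operators. -/
  m : L →L[ℝ] (G →L[ℝ] G)
  /-- A lower bound for the gradient. -/
  c : ℝ
  c_pos : 0 < c
  lower_bound : ∀ v, c * ‖v‖ ≤ ‖T v‖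
  norm_m_le : ∀ b, ‖m b‖ ≤ ‖b‖
  commute_m : ∀ a b, Commute (m a) (m b)
  isSelfAdjoint_m : ∀ b, IsSelfAdjoint (m b)

namespace LogAffineFamily

open ContinuousLinearMap

variable {V G L : Type*}
    [NormedAddCommGroup V] [InnerProductSpace ℝ V] [CompleteSpace V]
    [NormedAddCommGroup G] [InnerProductSpace ℝ G] [CompleteSpace G]
    [NormedAddCommGroup L] [NormedSpace ℝ L] (P : LogAffineFamily V G L)

/-- The coefficient `exp(m b)`, as an operator. -/
noncomputable def coeff (b : L) : G →L[ℝ] G := NormedSpace.exp (P.m b)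

/-- The operator `T* ζ exp(m b) T`. -/
noncomputable def form (ζ : G →L[ℝ] G) (b : L) : V →L[ℝ] V :=
  (adjoint P.T).comp ((ζ * P.coeff b).comp P.T)

/-- The solution operator `A(b)⁻¹`. -/
noncomputable def solve (b : L) : V →L[ℝ] V := Ring.inverse (P.form 1 b)

/-- The energy norm `⟪A(b) v, v⟫^{1/2}`. -/
noncomputable def energy (b : L) (v : V) : ℝ := ‖P.coeff ((1 / 2 : ℝ) • b) (P.T v)‖

/-- `ζ` commutes with all multiplication operators. -/
def IsLetter (ζ : G →L[ℝ] G) : Prop := ∀ b, Commute ζ (P.m b)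

theorem isLetter_m (h : L) : P.IsLetter (P.m h) := fun b => P.commute_m h b

variable {P} in
theorem IsLetter.mul {ζ η : G →L[ℝ] G} (hζ : P.IsLetter ζ) (hη : P.IsLetter η) :
    P.IsLetter (ζ * η) := fun b => (hζ b).mul_left (hη b)

variable {P} in
theorem IsLetter.commute_coeff {ζ : G →L[ℝ] G} (hζ : P.IsLetter ζ) (b : L) :
    Commute ζ (P.coeff b) := (hζ b).exp_right

theorem coeff_add (a b : L) : P.coeff (a + b) = P.coeff a * P.coeff b := by
  rw [coeff, map_add, exp_add_clm (P.commute_m a b), coeff, coeff]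

theorem coeff_half (b : L) :
    P.coeff b = P.coeff ((1 / 2 : ℝ) • b) * P.coeff ((1 / 2 : ℝ) • b) := by
  rw [← coeff_add, ← add_smul]; norm_num

theorem coeff_zero : P.coeff 0 = 1 := by simp [coeff]

theorem norm_coeff_le (b : L) : ‖P.coeff b‖ ≤ Real.exp ‖b‖ :=
  (norm_exp_clm_le _).trans (Real.exp_le_exp.2 (P.norm_m_le b))

theorem isSelfAdjoint_coeff (b : L) : IsSelfAdjoint (P.coeff b) :=
  (P.isSelfAdjoint_m b).exp

theorem inner_coeff_left (b : L) (g g' : G) :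
    inner ℝ (P.coeff b g) g' = inner ℝ g (P.coeff b g') := by
  have := (ContinuousLinearMap.isSelfAdjoint_iff_isSymmetric.1 (P.isSelfAdjoint_coeff b)) g g'
  simpa using this

theorem norm_le_norm_coeff (b : L) (g : G) : ‖g‖ ≤ Real.exp ‖b‖ * ‖P.coeff b g‖ := by
  have h : P.coeff (-b) (P.coeff b g) = g := by
    rw [← mul_apply_eq_comp, ← coeff_add]; simp [coeff_zero]
  calc ‖g‖ = ‖P.coeff (-b) (P.coeff b g)‖ := by rw [h]
    _ ≤ ‖P.coeff (-b)‖ * ‖P.coeff b g‖ := le_opNorm _ _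
    _ ≤ _ := by gcongr; simpa using P.norm_coeff_le (-b)

theorem inner_form (ζ : G →L[ℝ] G) (b : L) (v w : V) :
    inner ℝ (P.form ζ b v) w = inner ℝ (ζ (P.coeff b (P.T v))) (P.T w) := by
  simp [form, adjoint_inner_left]

/-- The form `T* ζ exp(m b) T` is symmetrically distributed over the two halves of `b`. -/
theorem inner_form_half {ζ : G →L[ℝ] G} (hζ : P.IsLetter ζ) (b : L) (v w : V) :
    inner ℝ (P.form ζ b v) w = inner ℝ (ζ (P.coeff ((1 / 2 : ℝ) • b) (P.T v)))
      (P.coeff ((1 / 2 : ℝ) • b) (P.T w)) := by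
  rw [inner_form, P.coeff_half b, ← inner_coeff_left]
  congr 1
  have h := (hζ.commute_coeff ((1 / 2 : ℝ) • b)).eq
  rw [← mul_apply_eq_comp, ← mul_apply_eq_comp,
    ← mul_apply_eq_comp, ← mul_assoc, ← h, mul_assoc]

theorem isLetter_one : P.IsLetter 1 := fun _ => Commute.one_left _

theorem inner_form_one_self (b : L) (v : V) :
    inner ℝ (P.form 1 b v) v = P.energy b v ^ 2 := by
  rw [P.inner_form_half P.isLetter_one, energy, ← real_inner_self_eq_norm_sq]; rfl

theorem energy_nonneg (b : L) (v : V) : 0 ≤ P.energy b v := norm_nonneg _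

theorem norm_le_energy (b : L) (v : V) :
    ‖v‖ ≤ P.c⁻¹ * Real.exp (‖b‖ / 2) * P.energy b v := by
  have h1 := P.lower_bound v
  have h2 := P.norm_le_norm_coeff ((1 / 2 : ℝ) • b) (P.T v)
  have h3 : ‖(1 / 2 : ℝ) • b‖ = ‖b‖ / 2 := by rw [norm_smul]; norm_num; ring
  rw [h3] at h2
  rw [mul_assoc, inv_mul_eq_div, le_div_iff₀ P.c_pos, mul_comm]
  exact h1.trans h2

/-- `A(b)` is invertible, by Lax–Milgram. -/
theorem isUnit_form_one (b : L) : IsUnit (P.form 1 b) := by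
  set k : ℝ := P.c⁻¹ * Real.exp (‖b‖ / 2) with hk
  have hk0 : 0 < k := mul_pos (inv_pos.2 P.c_pos) (Real.exp_pos _)
  refine isUnit_of_forall_le_norm_inner_map (P.form 1 b)
    (c := ⟨(k ^ 2)⁻¹, by positivity⟩) (NNReal.coe_pos.1 (inv_pos.2 (pow_pos hk0 2)))
    fun v => ?_
  rw [P.inner_form_one_self, Real.norm_of_nonneg (sq_nonneg _)]
  have h := pow_le_pow_left₀ (norm_nonneg v) (P.norm_le_energy b v) 2
  rw [mul_pow] at h
  change ‖v‖ ^ 2 * (k ^ 2)⁻¹ ≤ _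
  rw [← div_eq_mul_inv, div_le_iff₀ (by positivity), mul_comm]
  exact h

theorem form_solve (b : L) (F : V) : P.form 1 b (P.solve b F) = F := by
  have := Ring.mul_inverse_cancel _ (P.isUnit_form_one b)
  exact congrArg (fun f : V →L[ℝ] V => f F) this

theorem solve_form (b : L) (F : V) : P.solve b (P.form 1 b F) = F := by
  have := Ring.inverse_mul_cancel _ (P.isUnit_form_one b)
  exact congrArg (fun f : V →L[ℝ] V => f F) this

theorem energy_solve_le (b : L) (F : V) :
    P.energy b (P.solve b F) ≤ P.c⁻¹ * Real.exp (‖b‖ / 2) * ‖F‖ := by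
  set w := P.solve b F
  have h1 : P.energy b w ^ 2 = inner ℝ F w := by
    rw [← inner_form_one_self, form_solve]
  have h2 : P.energy b w ^ 2 ≤ (P.c⁻¹ * Real.exp (‖b‖ / 2) * ‖F‖) * P.energy b w := by
    rw [h1]
    refine (real_inner_le_norm _ _).trans ?_
    calc ‖F‖ * ‖w‖ ≤ ‖F‖ * (P.c⁻¹ * Real.exp (‖b‖ / 2) * P.energy b w) := by
          gcongr; exact P.norm_le_energy b w
      _ = _ := by ring
  have hc := P.c_pos
  by_contra! hlt
  have h0 : 0 < P.energy b w := lt_of_le_of_lt (by positivity) hlt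
  nlinarith

/-- In the energy norm, `A(b)⁻¹ T* ζ exp(m b) T` is bounded by `‖ζ‖`, uniformly in `b`. -/
theorem energy_solve_form_le {ζ : G →L[ℝ] G} (hζ : P.IsLetter ζ) (b : L) (v : V) :
    P.energy b (P.solve b (P.form ζ b v)) ≤ ‖ζ‖ * P.energy b v := by
  set w := P.solve b (P.form ζ b v)
  have h1 : P.energy b w ^ 2 = inner ℝ (P.form ζ b v) w := by
    rw [← inner_form_one_self, form_solve]
  have h2 : P.energy b w ^ 2 ≤ (‖ζ‖ * P.energy b v) * P.energy b w := by
    rw [h1, P.inner_form_half hζ]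
    refine (real_inner_le_norm _ _).trans ?_
    exact mul_le_mul_of_nonneg_right (le_opNorm _ _) (P.energy_nonneg b w)
  have hv := P.energy_nonneg b v
  by_contra! hlt
  have h0 : 0 < P.energy b w := lt_of_le_of_lt (by positivity) hlt
  nlinarith

/-- For a list `[ζ₁, …, ζₙ]` of operators, the vector
`A⁻¹ (T* ζ₁ exp(m b) T) A⁻¹ (T* ζ₂ exp(m b) T) ⋯ A⁻¹ F` with `A = A(b)`.  The derivatives of
`b ↦ A(b)⁻¹ F` are signed sums of such vectors. -/
noncomputable def word (F : V) (b : L) : List (G →L[ℝ] G) → V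
  | [] => P.solve b F
  | ζ :: l => P.solve b (P.form ζ b (word F b l))

theorem energy_word_le (F : V) (b : L) (l : List (G →L[ℝ] G)) (hl : ∀ ζ ∈ l, P.IsLetter ζ) :
    P.energy b (P.word F b l) ≤
      (l.map norm).prod * (P.c⁻¹ * Real.exp (‖b‖ / 2) * ‖F‖) := by
  induction l with
  | nil => simpa [word] using P.energy_solve_le b F
  | cons ζ l ih =>
    rw [List.map_cons, List.prod_cons, mul_assoc]
    refine (P.energy_solve_form_le (hl ζ (by simp)) b _).trans ?_
    gcongr
    exact ih fun η hη => hl η (by simp [hη])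

/-- Words are bounded by the product of their letters, up to a factor independent of their length:
the exponential of `‖b‖` is paid only once, in the passage from the energy norm. -/
theorem norm_word_le (F : V) (b : L) (l : List (G →L[ℝ] G)) (hl : ∀ ζ ∈ l, P.IsLetter ζ) :
    ‖P.word F b l‖ ≤ (l.map norm).prod * ((P.c⁻¹) ^ 2 * ‖F‖ * Real.exp ‖b‖) := by
  have hc := P.c_pos
  refine (P.norm_le_energy b _).trans ?_
  refine (mul_le_mul_of_nonneg_left (P.energy_word_le F b l hl) (by positivity)).trans_eq ?_
  have : Real.exp ‖b‖ = Real.exp (‖b‖ / 2) * Real.exp (‖b‖ / 2) := by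
    rw [← Real.exp_add]; ring_nf
  rw [this]; ring

theorem continuous_coeff : Continuous P.coeff := continuous_exp_clm.comp P.m.continuous

theorem continuous_form (ζ : G →L[ℝ] G) : Continuous (P.form ζ) := by
  have h := P.continuous_coeff
  unfold form
  exact continuous_const.clm_comp ((continuous_const.mul h).clm_comp continuous_const)

theorem continuous_solve : Continuous P.solve := by
  rw [continuous_iff_continuousAt]
  intro b
  obtain ⟨u, hu⟩ := P.isUnit_form_one b
  have h : ContinuousAt Ring.inverse (P.form 1 b) := hu ▸ NormedRing.inverse_continuousAt u
  exact ContinuousAt.comp h (P.continuous_form 1).continuousAt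

theorem continuous_word (F : V) (l : List (G →L[ℝ] G)) :
    Continuous fun b => P.word F b l := by
  induction l with
  | nil => exact P.continuous_solve.clm_apply continuous_const
  | cons ζ l ih => exact P.continuous_solve.clm_apply ((P.continuous_form ζ).clm_apply ih)

theorem hasDerivAt_coeff (b h : L) (t : ℝ) :
    HasDerivAt (fun s : ℝ => P.coeff (b + s • h)) (P.m h * P.coeff (b + t • h)) t := by
  have h1 := (hasDerivAt_exp_smul_const (𝕂 := ℝ) (P.m h) t).const_mul (P.coeff b)
  have h2 : ∀ s : ℝ, P.coeff (b + s • h) = P.coeff b * NormedSpace.exp (s • P.m h) := by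
    intro s
    rw [coeff_add]; simp [coeff]
  simp_rw [h2]
  refine h1.congr_deriv ?_
  rw [← map_smul]
  have e1 := ((P.isLetter_m h).commute_coeff b).eq
  have e2 := ((P.isLetter_m h).commute_coeff (t • h)).eq
  change P.coeff b * (P.coeff (t • h) * P.m h) = P.m h * (P.coeff b * P.coeff (t • h))
  rw [← mul_assoc (P.m h), e1, mul_assoc, e2]

theorem hasDerivAt_form {ζ : G →L[ℝ] G} (b h : L) (t : ℝ) :
    HasDerivAt (fun s : ℝ => P.form ζ (b + s • h)) (P.form (ζ * P.m h) (b + t • h)) t := by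
  have h1 := (P.hasDerivAt_coeff b h t).const_mul ζ
  let Φ : (G →L[ℝ] G) →L[ℝ] (V →L[ℝ] V) :=
    (compL ℝ V G V (adjoint P.T)).comp ((compL ℝ V G G).flip P.T)
  have h2 := Φ.hasFDerivAt.comp_hasDerivAt t h1
  refine h2.congr_deriv ?_
  simp [Φ, form, mul_assoc]

theorem hasDerivAt_solve (b h : L) (t : ℝ) :
    HasDerivAt (fun s : ℝ => P.solve (b + s • h))
      (-(P.solve (b + t • h) * P.form (P.m h) (b + t • h) * P.solve (b + t • h))) t := by
  obtain ⟨u, hu⟩ := P.isUnit_form_one (b + t • h)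
  have h1 := hasFDerivAt_ringInverse (𝕜 := ℝ) u
  rw [hu] at h1
  have h2 := h1.comp_hasDerivAt t (P.hasDerivAt_form (ζ := 1) b h t)
  refine h2.congr_deriv ?_
  have h3 : P.solve (b + t • h) = ↑u⁻¹ := by rw [solve, ← hu, Ring.inverse_unit]
  rw [h3]
  simp

/-- The derivative of a word in a direction `h` is a sum of at most `2n + 1` signed words of length
at most `n + 1`, `n` being the length of the word. -/
theorem exists_hasDerivAt_word (F : V) (h : L) (l : List (G →L[ℝ] G))
    (hl : ∀ ζ ∈ l, P.IsLetter ζ) :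
    ∃ W : List (ℝ × List (G →L[ℝ] G)),
      W.length ≤ 2 * l.length + 1 ∧
      (∀ w ∈ W, |w.1| ≤ 1 ∧ w.2.length ≤ l.length + 1 ∧ (∀ ζ ∈ w.2, P.IsLetter ζ) ∧
        (w.2.map norm).prod ≤ ‖h‖ * (l.map norm).prod) ∧
      ∀ (b : L) (t : ℝ), HasDerivAt (fun s : ℝ => P.word F (b + s • h) l)
        ((W.map fun w => w.1 • P.word F (b + t • h) w.2).sum) t := by
  induction l with
  | nil =>
    refine ⟨[(-1, [P.m h])], by simp, ?_, fun b t => ?_⟩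
    · simpa using ⟨P.isLetter_m h, P.norm_m_le h⟩
    · have := (P.hasDerivAt_solve b h t).clm_apply (hasDerivAt_const t F)
      simpa [word] using this
  | cons ζ l ih =>
    obtain ⟨W, hW1, hW2, hW3⟩ := ih fun η hη => hl η (by simp [hη])
    have hζ : P.IsLetter ζ := hl ζ (by simp)
    have hpos : 0 ≤ (l.map norm).prod := List.prod_nonneg (by simp)
    refine ⟨(-1, P.m h :: ζ :: l) :: (1, (ζ * P.m h) :: l) ::
      W.map (fun w => (w.1, ζ :: w.2)), ?_, ?_, fun b t => ?_⟩
    · simp only [List.length_cons, List.length_map]; omega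
    · intro w hw
      simp only [List.mem_cons, List.mem_map] at hw
      rcases hw with rfl | rfl | ⟨w, hw, rfl⟩
      · refine ⟨by simp, by simp, ?_, ?_⟩
        · intro η hη
          rcases List.mem_cons.1 hη with rfl | hη
          · exact P.isLetter_m h
          · exact hl η hη
        · simp only [List.map_cons, List.prod_cons]
          gcongr
          exact P.norm_m_le h
      · refine ⟨by simp, by simp, ?_, ?_⟩
        · intro η hη
          rcases List.mem_cons.1 hη with rfl | hη
          · exact hζ.mul (P.isLetter_m h)
          · exact hl η (by simp [hη])
        · simp only [List.map_cons, List.prod_cons]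
          rw [← mul_assoc]
          gcongr
          refine (norm_mul_le _ _).trans ?_
          rw [mul_comm]
          gcongr
          exact P.norm_m_le h
      · obtain ⟨h1, h2, h3, h4⟩ := hW2 w hw
        refine ⟨h1, by simpa using h2, ?_, ?_⟩
        · intro η hη
          rcases List.mem_cons.1 hη with rfl | hη
          · exact hζ
          · exact h3 η hη
        · simp only [List.map_cons, List.prod_cons]
          calc ‖ζ‖ * (w.2.map norm).prod ≤ ‖ζ‖ * (‖h‖ * (l.map norm).prod) := by gcongr
            _ = _ := by ring
    · have h1 := (P.hasDerivAt_solve b h t).clm_apply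
        ((P.hasDerivAt_form (ζ := ζ) b h t).clm_apply (hW3 b t))
      refine h1.congr_deriv ?_
      have key : ∀ W : List (ℝ × List (G →L[ℝ] G)),
          P.solve (b + t • h) (P.form ζ (b + t • h)
            ((W.map fun w => w.1 • P.word F (b + t • h) w.2).sum)) =
          (W.map fun w => w.1 • P.word F (b + t • h) (ζ :: w.2)).sum := by
        intro W
        induction W with
        | nil => simp
        | cons w W ihW =>
          simp only [List.map_cons, List.sum_cons, map_add, map_smul, ihW]
          rfl
      simp only [List.map_cons, List.sum_cons, List.map_map, map_add, key]
      simp [word, Function.comp_def]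

end LogAffineFamily

end LognormalPDE

/-! ### One-dimensional Gaussian integrals and Hermite polynomials -/

namespace LognormalPDE

section OneDim

variable {E : Type*} [NormedAddCommGroup E]

/-- `g` grows at most exponentially. -/
def ExpBounded (g : ℝ → E) : Prop := ∃ C c : ℝ, ∀ s, ‖g s‖ ≤ C * Real.exp (c * |s|)

theorem ExpBounded.exists_pos {g : ℝ → E} (h : ExpBounded g) :
    ∃ C c : ℝ, 0 ≤ C ∧ 0 ≤ c ∧ ∀ s, ‖g s‖ ≤ C * Real.exp (c * |s|) := by
  obtain ⟨C, c, h⟩ := h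
  refine ⟨|C|, |c|, abs_nonneg _, abs_nonneg _, fun s => (h s).trans ?_⟩
  gcongr <;> exact le_abs_self _

theorem ExpBounded.smul [NormedSpace ℝ E] {f : ℝ → ℝ} {g : ℝ → E} (hf : ExpBounded f)
    (hg : ExpBounded g) : ExpBounded fun s => f s • g s := by
  obtain ⟨C, c, hC, -, hf⟩ := hf.exists_pos
  obtain ⟨C', c', hC', -, hg⟩ := hg.exists_pos
  refine ⟨C * C', c + c', fun s => ?_⟩
  rw [norm_smul]
  calc ‖f s‖ * ‖g s‖ ≤ (C * Real.exp (c * |s|)) * (C' * Real.exp (c' * |s|)) := by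
        gcongr
        · exact hf s
        · exact hg s
    _ = _ := by rw [add_mul, Real.exp_add]; ring

theorem ExpBounded.mul {f g : ℝ → ℝ} (hf : ExpBounded f) (hg : ExpBounded g) :
    ExpBounded fun s => f s * g s := hf.smul hg

theorem ExpBounded.add {f g : ℝ → E} (hf : ExpBounded f) (hg : ExpBounded g) :
    ExpBounded fun s => f s + g s := by
  obtain ⟨C, c, hC, -, hf⟩ := hf.exists_pos
  obtain ⟨C', c', hC', -, hg⟩ := hg.exists_pos
  refine ⟨C + C', max c c', fun s => ?_⟩
  refine (norm_add_le _ _).trans ?_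
  rw [add_mul]
  refine add_le_add ((hf s).trans ?_) ((hg s).trans ?_) <;> gcongr
  · exact le_max_left _ _
  · exact le_max_right _ _

theorem expBounded_const (x : E) : ExpBounded fun _ : ℝ => x := ⟨‖x‖, 0, by simp⟩

theorem expBounded_id : ExpBounded fun s : ℝ => s := by
  refine ⟨1, 1, fun s => ?_⟩
  have := Real.add_one_le_exp |s|
  simp only [Real.norm_eq_abs, one_mul]; linarith

theorem expBounded_polynomial (p : Polynomial ℝ) : ExpBounded fun s : ℝ => p.eval s := by
  induction p using Polynomial.induction_on' with
  | add p q hp hq => simpa using hp.add hq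
  | monomial n a =>
    induction n with
    | zero => simpa using expBounded_const a
    | succ n ih =>
      have := ih.mul expBounded_id
      simpa [pow_succ, mul_assoc] using this

theorem expBounded_exp_mul_abs (c : ℝ) : ExpBounded fun s : ℝ => Real.exp (c * |s|) :=
  ⟨1, c, fun s => by simp⟩

theorem integrable_exp_mul_abs_gaussian (c : ℝ) :
    Integrable (fun s : ℝ => Real.exp (c * |s|)) (gaussianReal 0 1) := by
  refine ((integrable_exp_mul_gaussianReal (μ := 0) (v := 1) c).add
    (integrable_exp_mul_gaussianReal (-c))).mono' (by fun_prop) (.of_forall fun s => ?_)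
  rw [Real.norm_of_nonneg (Real.exp_pos _).le, Pi.add_apply]
  have h1 := Real.exp_pos (c * s)
  have h2 := Real.exp_pos (-c * s)
  rcases abs_cases s with ⟨h, _⟩ | ⟨h, _⟩ <;> rw [h]
  · linarith
  · rw [mul_neg, ← neg_mul]; linarith

theorem ExpBounded.integrable {g : ℝ → E} (hg : ExpBounded g)
    (hm : AEStronglyMeasurable g (gaussianReal 0 1)) : Integrable g (gaussianReal 0 1) := by
  obtain ⟨C, c, h⟩ := hg
  exact ((integrable_exp_mul_abs_gaussian c).const_mul C).mono' hm (.of_forall h)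

theorem ExpBounded.norm_sq {g : ℝ → E} (hg : ExpBounded g) : ExpBounded fun s => ‖g s‖ ^ 2 := by
  have h : ExpBounded fun s => ‖g s‖ := by
    obtain ⟨C, c, h⟩ := hg
    exact ⟨C, c, by simpa using h⟩
  simpa [sq] using h.mul h

theorem integrable_gaussian_iff [NormedSpace ℝ E] {g : ℝ → E} :
    Integrable g (gaussianReal 0 1) ↔ Integrable fun s => gaussianPDFReal 0 1 s • g s := by
  rw [gaussianReal_of_var_ne_zero 0 one_ne_zero,
    integrable_withDensity_iff_integrable_smul' (measurable_gaussianPDF 0 1)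
      (.of_forall fun _ => by simp [gaussianPDF])]
  simp [gaussianPDF, ENNReal.toReal_ofReal, gaussianPDFReal_nonneg]

/-- The Hermite polynomial `He_k` (monic, not normalized) as a function. -/
noncomputable def He (k : ℕ) (s : ℝ) : ℝ := Polynomial.aeval s (Polynomial.hermite k)

theorem He_eq_eval (k : ℕ) (s : ℝ) :
    He k s = ((Polynomial.hermite k).map (Int.castRingHom ℝ)).eval s := by
  simp [He, Polynomial.aeval_def, Polynomial.eval_map]

theorem He_zero (s : ℝ) : He 0 s = 1 := by simp [He]

theorem expBounded_He (k : ℕ) : ExpBounded (He k) := by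
  simpa only [← He_eq_eval] using
    expBounded_polynomial ((Polynomial.hermite k).map (Int.castRingHom ℝ))

theorem continuous_He (k : ℕ) : Continuous (He k) := by
  have : He k = fun s => ((Polynomial.hermite k).map (Int.castRingHom ℝ)).eval s :=
    funext (He_eq_eval k)
  rw [this]; fun_prop

theorem derivative_hermite_succ (k : ℕ) : Polynomial.derivative (Polynomial.hermite (k + 1)) =
    ((k : Polynomial ℤ) + 1) * Polynomial.hermite k := by
  induction k with
  | zero => simp
  | succ k ih =>
    rw [Polynomial.hermite_succ (k + 1), Polynomial.derivative_sub, Polynomial.derivative_mul, ih,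
      Polynomial.derivative_X, one_mul]
    have h2 : Polynomial.derivative (((k : Polynomial ℤ) + 1) * Polynomial.hermite k) =
        ((k : Polynomial ℤ) + 1) * Polynomial.derivative (Polynomial.hermite k) := by
      rw [Polynomial.derivative_mul]; simp
    rw [h2, Polynomial.hermite_succ k]; push_cast; ring

theorem hasDerivAt_He (k : ℕ) (s : ℝ) : HasDerivAt (He k)
    (Polynomial.aeval s (Polynomial.derivative (Polynomial.hermite k))) s :=
  (Polynomial.hermite k).hasDerivAt_aeval s

theorem hasDerivAt_He_succ (k : ℕ) (s : ℝ) :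
    HasDerivAt (He (k + 1)) (((k : ℝ) + 1) * He k s) s := by
  refine (hasDerivAt_He (k + 1) s).congr_deriv ?_
  rw [derivative_hermite_succ]; simp [He]

theorem hasDerivAt_He_mul_gaussian (k : ℕ) (s : ℝ) :
    HasDerivAt (fun s => gaussianPDFReal 0 1 s * He k s)
      (-(gaussianPDFReal 0 1 s * He (k + 1) s)) s := by
  have h1 : HasDerivAt (gaussianPDFReal 0 1) (-s * gaussianPDFReal 0 1 s) s := by
    have h : HasDerivAt (fun x : ℝ => -(x - 0) ^ 2 / (2 * ((1 : NNReal) : ℝ))) (-s) s := by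
      have := (((hasDerivAt_id s).sub_const 0).pow 2).neg.div_const (2 * ((1 : NNReal) : ℝ))
      refine this.congr_deriv ?_
      simp only [id, sub_zero, NNReal.coe_one]; norm_num; ring
    rw [gaussianPDFReal_def]
    refine (h.exp.const_mul _).congr_deriv ?_
    ring
  refine (h1.mul (hasDerivAt_He k s)).congr_deriv ?_
  simp only [He, Polynomial.hermite_succ, map_sub, map_mul, Polynomial.aeval_X]
  ring

variable [NormedSpace ℝ E] [CompleteSpace E]

/-- Gaussian integration by parts. -/
theorem integral_He_succ_smul {φ φ' : ℝ → E} (hφ : ∀ s, HasDerivAt φ (φ' s) s)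
    (hb : ExpBounded φ) (hb' : ExpBounded φ') (k : ℕ) :
    ∫ s, He (k + 1) s • φ s ∂gaussianReal 0 1 = ∫ s, He k s • φ' s ∂gaussianReal 0 1 := by
  have hφc : Continuous φ := continuous_iff_continuousAt.2 fun s => (hφ s).continuousAt
  have hφ'm : StronglyMeasurable φ' := by
    have : φ' = deriv φ := funext fun s => (hφ s).deriv.symm
    rw [this]; exact stronglyMeasurable_deriv φ
  have I : ∀ (j : ℕ) {ψ : ℝ → E}, StronglyMeasurable ψ → ExpBounded ψ →
      Integrable fun s => (gaussianPDFReal 0 1 s * He j s) • ψ s := by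
    intro j ψ hm hb
    have := ((expBounded_He j).smul hb).integrable
      ((continuous_He j).stronglyMeasurable.smul hm).aestronglyMeasurable
    simpa [mul_smul] using integrable_gaussian_iff.1 this
  have key := integral_bilinear_hasDerivAt_right_eq_neg_left_of_integrable
    (L := ContinuousLinearMap.lsmul ℝ ℝ) (u := fun s => gaussianPDFReal 0 1 s * He k s)
    (u' := fun s => -(gaussianPDFReal 0 1 s * He (k + 1) s)) (v := φ) (v' := φ')
    (fun s _ => hasDerivAt_He_mul_gaussian k s) (fun s _ => hφ s)
    (by simpa using I k hφ'm hb')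
    (by simpa using (I (k + 1) hφc.stronglyMeasurable hb).neg)
    (by simpa using I k hφc.stronglyMeasurable hb)
  rw [integral_gaussianReal_eq_integral_smul one_ne_zero,
    integral_gaussianReal_eq_integral_smul one_ne_zero]
  simp only [ContinuousLinearMap.lsmul_apply, neg_smul, integral_neg, neg_neg] at key
  simpa [mul_smul] using key.symm

theorem integral_He_mul_He (m n : ℕ) :
    ∫ s, He m s * He n s ∂gaussianReal 0 1 = if m = n then (n.factorial : ℝ) else 0 := by
  have h0 : ∀ n, ∫ s, He (n + 1) s * He 0 s ∂gaussianReal 0 1 = 0 := by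
    intro n
    have := integral_He_succ_smul (φ := He 0) (φ' := fun _ => 0)
      (fun s => (hasDerivAt_const s (1 : ℝ)).congr_of_eventuallyEq
        (Eventually.of_forall fun x => He_zero x)) (expBounded_He 0) (expBounded_const 0) n
    simpa using this
  induction m generalizing n with
  | zero =>
    rcases n with _ | n
    · simp [He_zero]
    · simp_rw [mul_comm (He 0 _)]
      simp [h0]
  | succ m ih =>
    rcases n with _ | n
    · simp [h0]
    · have := integral_He_succ_smul (φ := He (n + 1)) (φ' := fun s => ((n : ℝ) + 1) * He n s)
        (hasDerivAt_He_succ n) (expBounded_He _) ((expBounded_const _).mul (expBounded_He n)) m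
      simp only [smul_eq_mul] at this
      rw [this]
      simp_rw [mul_left_comm (He m _)]
      rw [integral_const_mul, ih]
      by_cases h : m = n
      · subst h; simp [Nat.factorial_succ]
      · simp [h]

end OneDim

/-! ### The Gaussian product measure -/

instance : IsProbabilityMeasure gaussianMeasure := by
  unfold gaussianMeasure; infer_instance

/-- Resampling one coordinate preserves the product Gaussian measure. -/
theorem measurePreserving_update (j : ℕ) :
    MeasurePreserving (fun p : (ℕ → ℝ) × ℝ => Function.update p.1 j p.2)
      (gaussianMeasure.prod (gaussianReal 0 1)) gaussianMeasure := by
  have hm : Measurable fun p : (ℕ → ℝ) × ℝ => Function.update p.1 j p.2 := by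
    refine measurable_pi_iff.2 fun i => ?_
    by_cases h : i = j
    · subst h; simpa using measurable_snd
    · simp only [Function.update_of_ne h]; fun_prop
  refine ⟨hm, ?_⟩
  refine Measure.eq_infinitePi _ fun s t ht => ?_
  rw [Measure.map_apply hm (MeasurableSet.pi s.countable_toSet fun i _ => ht i)]
  by_cases hj : j ∈ s
  · have : (fun p : (ℕ → ℝ) × ℝ => Function.update p.1 j p.2) ⁻¹' ((s : Set ℕ).pi t) =
        (((s.erase j : Finset ℕ) : Set ℕ).pi t) ×ˢ t j := by
      ext ⟨y, x⟩
      simp only [Set.mem_preimage, Set.mem_pi, Set.mem_prod, Finset.coe_erase]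
      constructor
      · intro h
        refine ⟨fun i hi => ?_, by simpa using h j hj⟩
        simpa [Function.update_of_ne hi.2] using h i hi.1
      · rintro ⟨h1, h2⟩ i hi
        by_cases hij : i = j
        · subst hij; simpa using h2
        · simpa [Function.update_of_ne hij] using h1 i ⟨hi, hij⟩
    rw [this, Measure.prod_prod, gaussianMeasure, Measure.infinitePi_pi _ fun i _ => ht i,
      Finset.prod_erase_mul _ _ hj]
  · have : (fun p : (ℕ → ℝ) × ℝ => Function.update p.1 j p.2) ⁻¹' ((s : Set ℕ).pi t) =
        ((s : Set ℕ).pi t) ×ˢ Set.univ := by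
      ext ⟨y, x⟩
      simp only [Set.mem_preimage, Set.mem_pi, Set.mem_prod, Set.mem_univ, and_true]
      refine forall₂_congr fun i hi => ?_
      rw [Function.update_of_ne (ne_of_mem_of_not_mem hi hj)]
    rw [this, Measure.prod_prod, gaussianMeasure, Measure.infinitePi_pi _ fun i _ => ht i]
    simp

theorem integral_gaussianMeasure_update {E : Type*} [NormedAddCommGroup E] [NormedSpace ℝ E]
    {F : (ℕ → ℝ) → E} (hF : Integrable F gaussianMeasure) (j : ℕ) :
    ∫ y, F y ∂gaussianMeasure =
      ∫ y, ∫ s, F (Function.update y j s) ∂gaussianReal 0 1 ∂gaussianMeasure := by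
  have h := measurePreserving_update j
  have hF' : Integrable F
      ((gaussianMeasure.prod (gaussianReal 0 1)).map
        fun p : (ℕ → ℝ) × ℝ => Function.update p.1 j p.2) := by rwa [h.map_eq]
  have h1 := integral_prod _ (hF'.comp_measurable h.measurable)
  have h2 := integral_map h.measurable.aemeasurable hF'.aestronglyMeasurable
  rw [h.map_eq] at h2
  rw [h2]
  exact h1

theorem prod_update_of_notMem {M : Type*} [CommMonoid M] {I : Finset ℕ} {j : ℕ} (hj : j ∉ I)
    (g : ℕ → ℝ → M) (y : ℕ → ℝ) (s : ℝ) :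
    ∏ i ∈ I, g i (Function.update y j s i) = ∏ i ∈ I, g i (y i) :=
  Finset.prod_congr rfl fun i hi => by rw [Function.update_of_ne (ne_of_mem_of_not_mem hi hj)]

theorem integral_prod_gaussianMeasure (I : Finset ℕ) (g : ℕ → ℝ → ℝ)
    (hg : ∀ i, Measurable (g i)) :
    ∫ y, ∏ i ∈ I, g i (y i) ∂gaussianMeasure = ∏ i ∈ I, ∫ s, g i s ∂gaussianReal 0 1 := by
  induction I using Finset.induction_on with
  | empty => simp
  | insert j I hj ih =>
    have h := measurePreserving_update j
    have hm : Measurable fun y : ℕ → ℝ => ∏ i ∈ insert j I, g i (y i) :=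
      Finset.measurable_prod _ fun i _ => (hg i).comp (measurable_pi_apply i)
    rw [← h.map_eq, integral_map h.measurable.aemeasurable hm.aestronglyMeasurable]
    simp only [Finset.prod_insert hj, prod_update_of_notMem hj, Function.update_self]
    simp_rw [mul_comm (g j _)]
    rw [integral_prod_mul (fun y : ℕ → ℝ => ∏ i ∈ I, g i (y i)) (g j), ih, mul_comm]

theorem lintegral_prod_gaussianMeasure (I : Finset ℕ) (g : ℕ → ℝ → ℝ≥0∞)
    (hg : ∀ i, Measurable (g i)) :
    ∫⁻ y, ∏ i ∈ I, g i (y i) ∂gaussianMeasure = ∏ i ∈ I, ∫⁻ s, g i s ∂gaussianReal 0 1 := by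
  induction I using Finset.induction_on with
  | empty => simp
  | insert j I hj ih =>
    have h := measurePreserving_update j
    have hm' : ∀ I : Finset ℕ, Measurable fun y : ℕ → ℝ => ∏ i ∈ I, g i (y i) := fun I =>
      Finset.measurable_prod _ fun i _ => (hg i).comp (measurable_pi_apply i)
    rw [← h.map_eq, lintegral_map (hm' _) h.measurable]
    simp only [Finset.prod_insert hj, prod_update_of_notMem hj, Function.update_self]
    simp_rw [mul_comm (g j _)]
    rw [lintegral_prod_mul (hm' I).aemeasurable (hg j).aemeasurable, ih, mul_comm]

theorem memLp_two_prod_gaussianMeasure (I : Finset ℕ) (g : ℕ → ℝ → ℝ)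
    (hg : ∀ i, Measurable (g i)) (hb : ∀ i, ExpBounded (g i)) :
    MemLp (fun y : ℕ → ℝ => ∏ i ∈ I, g i (y i)) 2 gaussianMeasure := by
  have hm : Measurable fun y : ℕ → ℝ => ∏ i ∈ I, g i (y i) :=
    Finset.measurable_prod _ fun i _ => (hg i).comp (measurable_pi_apply i)
  rw [memLp_two_iff_integrable_sq hm.aestronglyMeasurable]
  refine ⟨(hm.pow_const 2).aestronglyMeasurable, ?_⟩
  rw [HasFiniteIntegral]
  have : ∀ y : ℕ → ℝ, ‖(∏ i ∈ I, g i (y i)) ^ 2‖ₑ = ∏ i ∈ I, ‖g i (y i) ^ 2‖ₑ := by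
    intro y
    rw [← Finset.prod_pow, ← ofReal_norm, norm_prod,
      ENNReal.ofReal_prod_of_nonneg fun _ _ => norm_nonneg _]
    simp only [ofReal_norm]
  simp_rw [this]
  rw [lintegral_prod_gaussianMeasure I (fun i s => ‖g i s ^ 2‖ₑ)
    fun i => ((hg i).pow_const 2).enorm]
  refine ENNReal.prod_lt_top fun i _ => ?_
  have h : Integrable (fun s => g i s ^ 2) (gaussianReal 0 1) := by
    have := (hb i).norm_sq.integrable (by
      exact ((hg i).norm.pow_const 2).aestronglyMeasurable)
    simpa using this
  exact h.2

/-! ### Tensorized Hermite polynomials -/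

/-- `∏_j He_{ν_j}(y_j)`. -/
noncomputable def HeF (ν : ℕ →₀ ℕ) (y : ℕ → ℝ) : ℝ := ∏ j ∈ ν.support, He (ν j) (y j)

/-- `ν! = ∏_j ν_j!`. -/
noncomputable def factorialF (ν : ℕ →₀ ℕ) : ℝ := ∏ j ∈ ν.support, ((ν j).factorial : ℝ)

theorem factorialF_pos (ν : ℕ →₀ ℕ) : 0 < factorialF ν :=
  Finset.prod_pos fun _ _ => by positivity

theorem hermiteF_eq (ν : ℕ →₀ ℕ) (y : ℕ → ℝ) :
    hermiteF ν y = (Real.sqrt (factorialF ν))⁻¹ * HeF ν y := by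
  simp only [hermiteF, hermite1, HeF, He, factorialF, Finset.prod_div_distrib]
  rw [← Real.sqrt_prod _ fun _ _ => by positivity]
  ring

theorem HeF_eq_prod {ν : ℕ →₀ ℕ} {I : Finset ℕ} (h : ν.support ⊆ I) (y : ℕ → ℝ) :
    HeF ν y = ∏ j ∈ I, He (ν j) (y j) :=
  Finset.prod_subset h fun j _ hj => by simp [Finsupp.notMem_support_iff.1 hj, He_zero]

theorem factorialF_eq_prod {ν : ℕ →₀ ℕ} {I : Finset ℕ} (h : ν.support ⊆ I) :
    factorialF ν = ∏ j ∈ I, ((ν j).factorial : ℝ) :=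
  Finset.prod_subset h fun j _ hj => by simp [Finsupp.notMem_support_iff.1 hj]

theorem integral_HeF_mul_HeF (ν μ : ℕ →₀ ℕ) :
    ∫ y, HeF ν y * HeF μ y ∂gaussianMeasure = if ν = μ then factorialF ν else 0 := by
  set I := ν.support ∪ μ.support
  simp_rw [HeF_eq_prod (ν := ν) (I := I) Finset.subset_union_left,
    HeF_eq_prod (ν := μ) (I := I) Finset.subset_union_right, ← Finset.prod_mul_distrib]
  rw [integral_prod_gaussianMeasure I (fun j s => He (ν j) s * He (μ j) s)
    fun _ => ((continuous_He _).mul (continuous_He _)).measurable]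
  simp_rw [integral_He_mul_He]
  split_ifs with h
  · subst h; simp [factorialF_eq_prod (ν := ν) (I := I) Finset.subset_union_left]
  · obtain ⟨j, hj⟩ := Finsupp.ne_iff.1 h
    refine Finset.prod_eq_zero (i := j) ?_ (by simp [hj])
    simp only [I, Finset.mem_union, Finsupp.mem_support_iff]
    omega

theorem memLp_HeF (ν : ℕ →₀ ℕ) : MemLp (HeF ν) 2 gaussianMeasure :=
  memLp_two_prod_gaussianMeasure _ (fun j => He (ν j)) (fun _ => (continuous_He _).measurable)
    fun _ => expBounded_He _

theorem integral_hermiteF_mul_hermiteF (ν μ : ℕ →₀ ℕ) :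
    ∫ y, hermiteF ν y * hermiteF μ y ∂gaussianMeasure = if ν = μ then 1 else 0 := by
  simp_rw [hermiteF_eq, mul_mul_mul_comm _ (HeF ν _)]
  rw [integral_const_mul, integral_HeF_mul_HeF]
  split_ifs with h
  · subst h
    rw [← mul_inv, Real.mul_self_sqrt (factorialF_pos ν).le, inv_mul_cancel₀ (factorialF_pos ν).ne']
  · simp

theorem memLp_hermiteF (ν : ℕ →₀ ℕ) : MemLp (hermiteF ν) 2 gaussianMeasure := by
  have : hermiteF ν = fun y => (Real.sqrt (factorialF ν))⁻¹ * HeF ν y := funext (hermiteF_eq ν)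
  rw [this]; exact (memLp_HeF ν).const_mul _

theorem HeF_add_single_of_notMem {ν : ℕ →₀ ℕ} {j : ℕ} (hj : j ∉ ν.support) (k : ℕ)
    (y : ℕ → ℝ) : HeF (ν + Finsupp.single j k) y = HeF ν y * He k (y j) := by
  have hs : (ν + Finsupp.single j k).support ⊆ insert j ν.support := by
    intro i hi
    by_cases h : i = j
    · simp [h]
    · simpa [h, Ne.symm h] using hi
  rw [HeF_eq_prod hs, Finset.prod_insert hj, mul_comm, HeF]
  congr 1
  · refine Finset.prod_congr rfl fun i hi => ?_
    have : j ≠ i := fun h => hj (h ▸ hi)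
    simp [this]
  · simp [Finsupp.notMem_support_iff.1 hj]

theorem HeF_update (ν : ℕ →₀ ℕ) (j : ℕ) (y : ℕ → ℝ) (s : ℝ) :
    HeF ν (Function.update y j s) = HeF (ν.erase j) y * He (ν j) s := by
  conv_lhs => rw [← Finsupp.erase_add_single j ν]
  rw [HeF_add_single_of_notMem (by simp), Function.update_self]
  congr 1
  exact prod_update_of_notMem (by simp) (fun i => He ((ν.erase j) i)) y s

end LognormalPDE

/-! ### Completeness of the Hermite polynomials -/

namespace LognormalPDE

section Moments

variable {Ω : Type*} [MeasurableSpace Ω] {μ : Measure Ω} {X h : Ω → ℝ}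

theorem integrable_expBounded_comp_mul (hX : Measurable X) (hh : AEStronglyMeasurable h μ)
    (hint : ∀ t, Integrable (fun z => Real.exp (t * |X z|) * h z) μ) {g : ℝ → ℝ}
    (hg : Measurable g) (hb : ExpBounded g) : Integrable (fun z => g (X z) * h z) μ := by
  obtain ⟨C, c, hC⟩ := hb
  refine ((hint c).const_mul C).mono ((hg.comp hX).aestronglyMeasurable.mul hh)
    (.of_forall fun z => ?_)
  rw [norm_mul, norm_mul, norm_mul, ← mul_assoc]
  gcongr
  refine (hC (X z)).trans ?_
  rw [Real.norm_of_nonneg (Real.exp_pos _).le]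
  gcongr
  exact Real.le_norm_self C

theorem integral_polynomial_mul_eq_zero (hX : Measurable X) (hh : AEStronglyMeasurable h μ)
    (hint : ∀ t, Integrable (fun z => Real.exp (t * |X z|) * h z) μ)
    (hmom : ∀ k, ∫ z, He k (X z) * h z ∂μ = 0) (p : Polynomial ℝ) :
    ∫ z, p.eval (X z) * h z ∂μ = 0 := by
  have hI : ∀ p : Polynomial ℝ, Integrable (fun z => p.eval (X z) * h z) μ := fun p =>
    integrable_expBounded_comp_mul hX hh hint p.continuous.measurable (expBounded_polynomial p)
  let ℓ : Polynomial ℝ →ₗ[ℝ] ℝ :=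
    { toFun := fun p => ∫ z, p.eval (X z) * h z ∂μ
      map_add' := fun p q => by
        rw [← integral_add (hI p) (hI q)]; simp [add_mul]
      map_smul' := fun c p => by
        rw [RingHom.id_apply, smul_eq_mul, ← integral_const_mul]; simp [mul_assoc] }
  have hmonic : ∀ k, ((Polynomial.hermite k).map (Int.castRingHom ℝ)).Monic := fun k =>
    (Polynomial.hermite_monic k).map _
  let S : Polynomial.Sequence ℝ :=
    { elems' := fun k => (Polynomial.hermite k).map (Int.castRingHom ℝ)
      degree_eq' := fun k => by
        rw [(Polynomial.hermite_monic k).degree_map, Polynomial.degree_hermite] }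
  have hS : Submodule.span ℝ (Set.range fun k => S k) = ⊤ := S.span fun k => by
    have : (S k).leadingCoeff = 1 := hmonic k
    simp [this]
  have h0 : ℓ = 0 := by
    refine LinearMap.ext_on_range hS fun k => ?_
    have := hmom k
    simp only [He_eq_eval] at this
    simpa [ℓ] using this
  exact congrArg (fun f : Polynomial ℝ →ₗ[ℝ] ℝ => f p) h0

theorem integral_exp_mul_eq_zero (hX : Measurable X) (hh : AEStronglyMeasurable h μ)
    (hint : ∀ t, Integrable (fun z => Real.exp (t * |X z|) * h z) μ)
    (hmom : ∀ k, ∫ z, He k (X z) * h z ∂μ = 0) (t : ℝ) :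
    ∫ z, Real.exp (t * X z) * h z ∂μ = 0 := by
  have hs : ∀ x : ℝ, HasSum (fun n : ℕ => ((n.factorial : ℝ)⁻¹) * x ^ n) (Real.exp x) := by
    intro x
    have := NormedSpace.exp_series_hasSum_exp' (𝕂 := ℝ) x
    rw [← Real.exp_eq_exp_ℝ] at this
    simpa [smul_eq_mul] using this
  have key := hasSum_integral_of_dominated_convergence (μ := μ)
    (F := fun (n : ℕ) z => ((n.factorial : ℝ)⁻¹ * (t * X z) ^ n) * h z)
    (f := fun z => Real.exp (t * X z) * h z)
    (bound := fun n z => ((n.factorial : ℝ)⁻¹ * (|t| * |X z|) ^ n) * |h z|)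
    (fun n => ((((hX.const_mul t).pow_const n).const_mul _).aestronglyMeasurable).mul hh)
    (fun n => .of_forall fun z => by
      simp [mul_pow])
    (.of_forall fun z => ((hs _).mul_right _).summable)
    (by
      simp_rw [fun z => ((hs (|t| * |X z|)).mul_right |h z|).tsum_eq]
      have := (hint |t|).abs
      simpa [abs_mul] using this)
    (.of_forall fun z => (hs _).mul_right _)
  have hz : ∀ n : ℕ, ∫ z, ((n.factorial : ℝ)⁻¹ * (t * X z) ^ n) * h z ∂μ = 0 := by
    intro n
    have := integral_polynomial_mul_eq_zero hX hh hint hmom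
      (Polynomial.C (n.factorial : ℝ)⁻¹ * (Polynomial.C t * Polynomial.X) ^ n)
    simpa using this
  simp_rw [hz] at key
  exact key.unique hasSum_zero

/-- A density with exponential moments along `X` that is orthogonal to all polynomials in `X` is
orthogonal to all functions of `X`: its positive and negative parts have the same moment generating
function along `X`. -/
theorem setIntegral_eq_zero_of_hermite_moments (hX : Measurable X)
    (hh : AEStronglyMeasurable h μ)
    (hint : ∀ t, Integrable (fun z => Real.exp (t * |X z|) * h z) μ)
    (hmom : ∀ k, ∫ z, He k (X z) * h z ∂μ = 0) {B : Set ℝ} (hB : MeasurableSet B) :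
    ∫ z in X ⁻¹' B, h z ∂μ = 0 := by
  have hhi : Integrable h μ := by simpa using hint 0
  have hexp : ∀ t : ℝ, Integrable (fun z => Real.exp (t * X z) * h z) μ := fun t =>
    integrable_expBounded_comp_mul hX hh hint (g := fun s => Real.exp (t * s)) (by fun_prop)
      ⟨1, |t|, fun s => by
        rw [Real.norm_of_nonneg (Real.exp_pos _).le, one_mul, ← abs_mul]
        exact Real.exp_le_exp.2 (le_abs_self _)⟩
  have hmp : AEMeasurable (fun z => ENNReal.ofReal (h z)) μ := hh.aemeasurable.ennreal_ofReal
  have hmn : AEMeasurable (fun z => ENNReal.ofReal (-h z)) μ :=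
    hh.aemeasurable.neg.ennreal_ofReal
  set μp := μ.withDensity fun z => ENNReal.ofReal (h z)
  set μn := μ.withDensity fun z => ENNReal.ofReal (-h z)
  have : IsFiniteMeasure μp := isFiniteMeasure_withDensity_ofReal hhi.2
  have : IsFiniteMeasure μn := isFiniteMeasure_withDensity_ofReal hhi.neg.2
  have hpart : ∀ (k : Ω → ℝ), (∀ z, |k z| ≤ |h z|) → AEStronglyMeasurable k μ → ∀ t : ℝ,
      Integrable (fun z => Real.exp (t * X z) * k z) μ := by
    intro k hk hkm t
    refine (hexp t).mono (((hX.const_mul t).exp).aestronglyMeasurable.mul hkm)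
      (.of_forall fun z => ?_)
    rw [norm_mul, norm_mul]
    gcongr
    exact hk z
  have hip : ∀ t : ℝ, Integrable (fun z => Real.exp (t * X z) * max (h z) 0) μ :=
    hpart _ (fun z => by
      rcases max_cases (h z) 0 with ⟨h1, _⟩ | ⟨h1, _⟩ <;> simp [h1])
      (hh.sup aestronglyMeasurable_const)
  have hin : ∀ t : ℝ, Integrable (fun z => Real.exp (t * X z) * max (-h z) 0) μ :=
    hpart _ (fun z => by
      rcases max_cases (-h z) 0 with ⟨h1, _⟩ | ⟨h1, _⟩ <;> simp [h1])
      (hh.neg.sup aestronglyMeasurable_const)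
  have hmgf : mgf X μp = mgf X μn := by
    ext t
    simp only [mgf, μp, μn]
    rw [integral_withDensity_eq_integral_toReal_smul₀ hmp (.of_forall fun _ => by simp),
      integral_withDensity_eq_integral_toReal_smul₀ hmn (.of_forall fun _ => by simp)]
    simp only [ENNReal.toReal_ofReal', smul_eq_mul]
    rw [← sub_eq_zero]
    simp_rw [mul_comm _ (Real.exp _)]
    rw [← integral_sub (hip t) (hin t)]
    refine Eq.trans ?_ (integral_exp_mul_eq_zero hX hh hint hmom t)
    refine integral_congr_ae (.of_forall fun z => ?_)
    simp only [← mul_sub]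
    have hz : max (h z) 0 - max (-h z) 0 = h z := by
      rcases le_total 0 (h z) with h0 | h0
      · rw [max_eq_left h0, max_eq_right (by linarith), sub_zero]
      · rw [max_eq_right h0, max_eq_left (by linarith)]; ring
    rw [hz]
  have hset : integrableExpSet X μp = Set.univ := by
    refine Set.eq_univ_of_forall fun t => ?_
    change Integrable _ _
    rw [integrable_withDensity_iff_integrable_smul₀' hmp (.of_forall fun _ => by simp)]
    simpa [ENNReal.toReal_ofReal', mul_comm] using hip t
  have hzero : μp = 0 ↔ μn = 0 := by
    have h0 := congrFun hmgf 0
    simp only [mgf_zero', measureReal_def] at h0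
    rw [ENNReal.toReal_eq_toReal_iff' (measure_ne_top _ _) (measure_ne_top _ _)] at h0
    rw [← Measure.measure_univ_eq_zero, h0, Measure.measure_univ_eq_zero]
  have hc := eqOn_complexMGF_of_mgf' hmgf hzero
  have hmap : μp.map X = μn.map X := Measure.ext_of_complexMGF_eq hX.aemeasurable
    hX.aemeasurable (funext fun ζ => hc (by simp [hset]))
  have hBB := congrArg (fun m : Measure ℝ => m B) hmap
  simp only [Measure.map_apply hX hB, μp, μn, withDensity_apply _ (hX hB)] at hBB
  rw [integral_eq_lintegral_pos_part_sub_lintegral_neg_part hhi.integrableOn, hBB, sub_self]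

end Moments

/-- A square integrable function orthogonal to all Hermite polynomials is orthogonal to the products
of indicators of finitely many coordinates and Hermite polynomials of the other ones. -/
theorem integral_indicator_mul_HeF_eq_zero {w : (ℕ → ℝ) → ℝ} (hw : MemLp w 2 gaussianMeasure)
    (h0 : ∀ ν, ∫ y, HeF ν y * w y ∂gaussianMeasure = 0) (B : ℕ → Set ℝ)
    (hB : ∀ i, MeasurableSet (B i)) (I : Finset ℕ) (ν : ℕ →₀ ℕ) (hν : Disjoint ν.support I) :
    ∫ y, (∏ i ∈ I, (B i).indicator 1 (y i)) * HeF ν y * w y ∂gaussianMeasure = 0 := by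
  induction I using Finset.induction_on generalizing ν with
  | empty => simpa using h0 ν
  | insert j I hj ih =>
    rw [Finset.disjoint_insert_right] at hν
    set h : (ℕ → ℝ) → ℝ := fun y => (∏ i ∈ I, (B i).indicator 1 (y i)) * HeF ν y * w y with hh
    have hprod : ∀ t : ℝ, MemLp (fun y : ℕ → ℝ => Real.exp (t * |y j|) *
        ((∏ i ∈ I, (B i).indicator 1 (y i)) * HeF ν y)) 2 gaussianMeasure := by
      intro t
      let g : ℕ → ℝ → ℝ := fun i s =>
        if i = j then Real.exp (t * |s|) else if i ∈ I then (B i).indicator 1 s else He (ν i) s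
      have hgm : ∀ i, Measurable (g i) := by
        intro i
        simp only [g]
        split_ifs
        · fun_prop
        · exact measurable_one.indicator (hB i)
        · exact (continuous_He _).measurable
      have hgb : ∀ i, ExpBounded (g i) := by
        intro i
        simp only [g]
        split_ifs
        · exact expBounded_exp_mul_abs t
        · refine ⟨1, 0, fun s => ?_⟩
          by_cases hs : s ∈ B i <;> simp [hs]
        · exact expBounded_He _
      have := memLp_two_prod_gaussianMeasure (insert j (I ∪ ν.support)) g hgm hgb
      convert this using 2 with y
      have hjn : j ∉ I ∪ ν.support := by simp only [Finset.mem_union]; tauto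
      rw [Finset.prod_insert hjn, Finset.prod_union hν.2.symm]
      congr 1
      · simp [g]
      · rw [HeF]
        congr 1
        · refine Finset.prod_congr rfl fun i hi => ?_
          have : i ≠ j := ne_of_mem_of_not_mem hi hj
          simp [g, this, hi]
        · refine Finset.prod_congr rfl fun i hi => ?_
          have h1 : i ≠ j := ne_of_mem_of_not_mem hi hν.1
          have h2 : i ∉ I := Finset.disjoint_left.1 hν.2 hi
          simp [g, h1, h2]
    have hint : ∀ t, Integrable (fun y => Real.exp (t * |y j|) * h y) gaussianMeasure := by
      intro t
      have := (hprod t).integrable_mul hw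
      refine this.congr (.of_forall fun y => ?_)
      simp only [Pi.mul_apply, hh]; ring
    have hhm : AEStronglyMeasurable h gaussianMeasure := by
      have := (hint 0).1
      simpa using this
    have hmom : ∀ k, ∫ y, He k (y j) * h y ∂gaussianMeasure = 0 := by
      intro k
      rw [← ih (ν + Finsupp.single j k) ?_]
      · refine integral_congr_ae (.of_forall fun y => ?_)
        simp only [hh]
        rw [HeF_add_single_of_notMem hν.1]; ring
      · rw [Finset.disjoint_left]
        intro i hi hiI
        have h1 : j ≠ i := (ne_of_mem_of_not_mem hiI hj).symm
        have h2 : i ∉ ν.support := Finset.disjoint_right.1 hν.2 hiI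
        simp [h1, Finsupp.notMem_support_iff.1 h2] at hi
    have := setIntegral_eq_zero_of_hermite_moments (measurable_pi_apply j) hhm hint hmom (hB j)
    rw [← integral_indicator ((measurable_pi_apply j) (hB j))] at this
    rw [← this]
    refine integral_congr_ae (.of_forall fun y => ?_)
    simp only [hh, Finset.prod_insert hj]
    by_cases hy : y j ∈ B j
    · have hy' : y ∈ (fun f : ℕ → ℝ => f j) ⁻¹' B j := hy
      rw [Set.indicator_of_mem hy, Set.indicator_of_mem hy']
      simp
    · have hy' : y ∉ (fun f : ℕ → ℝ => f j) ⁻¹' B j := hy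
      rw [Set.indicator_of_notMem hy, Set.indicator_of_notMem hy']
      simp

theorem ae_eq_zero_of_integral_HeF_eq_zero_real {w : (ℕ → ℝ) → ℝ}
    (hw : MemLp w 2 gaussianMeasure) (h0 : ∀ ν, ∫ y, HeF ν y * w y ∂gaussianMeasure = 0)
    {A : Set (ℕ → ℝ)} (hA : MeasurableSet A) : ∫ y in A, w y ∂gaussianMeasure = 0 := by
  have hwi : Integrable w gaussianMeasure := hw.integrable (by norm_num)
  have huniv : ∫ y, w y ∂gaussianMeasure = 0 := by simpa [HeF] using h0 0
  refine MeasurableSpace.induction_on_inter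
    (C := fun A _ => ∫ y in A, w y ∂gaussianMeasure = 0)
    generateFrom_squareCylinders.symm
    (isPiSystem_squareCylinders (fun _ => MeasurableSpace.isPiSystem_measurableSet)
      fun _ => Set.mem_ofPred.2 MeasurableSet.univ) (by simp) ?_ ?_ ?_ A hA
  · rintro _ ⟨I, B, hB, rfl⟩
    have hB' : ∀ i, MeasurableSet (B i) := fun i => hB i (Set.mem_univ i)
    have := integral_indicator_mul_HeF_eq_zero hw h0 B hB' I 0 (by simp)
    rw [← integral_indicator (MeasurableSet.pi I.countable_toSet fun i _ => hB' i), ← this]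
    refine integral_congr_ae (.of_forall fun y => ?_)
    simp only [HeF, Finsupp.support_zero, Finset.prod_empty, mul_one]
    by_cases hy : y ∈ (I : Set ℕ).pi B
    · rw [Set.indicator_of_mem hy, Finset.prod_eq_one, one_mul]
      intro i hi
      rw [Set.indicator_of_mem (hy i hi)]; rfl
    · rw [Set.indicator_of_notMem hy]
      simp only [Set.mem_pi, not_forall] at hy
      obtain ⟨i, hi, hyi⟩ := hy
      rw [Finset.prod_eq_zero hi (Set.indicator_of_notMem hyi _), zero_mul]
  · intro A hA h
    have := integral_add_compl hA hwi
    rw [h, huniv, zero_add] at this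
    exact this
  · intro f hd hf h
    rw [integral_iUnion hf hd hwi.integrableOn]
    simp [h]

/-- The Hermite polynomials are total in `L²(γ)`, also for functions with values in a Hilbert
space. -/
theorem ae_eq_zero_of_integral_HeF_eq_zero {G : Type*} [NormedAddCommGroup G]
    [InnerProductSpace ℝ G] [CompleteSpace G] {w : (ℕ → ℝ) → G}
    (hw : MemLp w 2 gaussianMeasure)
    (h0 : ∀ (ν : ℕ →₀ ℕ) (x : G), ∫ y, HeF ν y * inner ℝ x (w y) ∂gaussianMeasure = 0) :
    w =ᵐ[gaussianMeasure] 0 := by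
  have hwi : Integrable w gaussianMeasure := hw.integrable (by norm_num)
  refine hwi.ae_eq_zero_of_forall_setIntegral_eq_zero fun A hA _ => ?_
  refine ext_inner_left ℝ fun x => ?_
  rw [inner_zero_right, ← integral_inner hwi.integrableOn]
  exact ae_eq_zero_of_integral_HeF_eq_zero_real (hw.const_inner x) (fun ν => h0 ν x) hA

/-! ### The Parseval identity for Hermite expansions -/

section Parseval

variable {G : Type*} [NormedAddCommGroup G] [InnerProductSpace ℝ G]

theorem memLp_hermiteF_smul (ν : ℕ →₀ ℕ) (x : G) :
    MemLp (fun y => hermiteF ν y • x) 2 gaussianMeasure :=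
  (memLp_top_const (μ := gaussianMeasure) x).smul (memLp_hermiteF ν)

theorem inner_hermiteF_smul (ν μ : ℕ →₀ ℕ) (x x' : G) :
    inner ℝ ((memLp_hermiteF_smul ν x).toLp _) ((memLp_hermiteF_smul μ x').toLp _) =
      if ν = μ then inner ℝ x x' else 0 := by
  rw [L2.inner_def]
  have : ∀ᵐ y ∂gaussianMeasure, inner ℝ ((memLp_hermiteF_smul ν x).toLp _ y)
      ((memLp_hermiteF_smul μ x').toLp _ y) = (hermiteF ν y * hermiteF μ y) * inner ℝ x x' := by
    filter_upwards [(memLp_hermiteF_smul ν x).coeFn_toLp,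
      (memLp_hermiteF_smul μ x').coeFn_toLp] with y h1 h2
    rw [h1, h2, real_inner_smul_left, real_inner_smul_right, mul_assoc]
  rw [integral_congr_ae this, integral_mul_const, integral_hermiteF_mul_hermiteF]
  split_ifs <;> simp

/-- The embedding `x ↦ H_ν x` of `G` into `L²(γ; G)`. -/
noncomputable def hermiteEmbedding (ν : ℕ →₀ ℕ) : G →ₗᵢ[ℝ] Lp G 2 gaussianMeasure where
  toFun x := (memLp_hermiteF_smul ν x).toLp _
  map_add' x x' := by
    rw [← MemLp.toLp_add]
    exact MemLp.toLp_congr _ _ (.of_forall fun y => by simp)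
  map_smul' c x := by
    rw [RingHom.id_apply, ← MemLp.toLp_const_smul]
    exact MemLp.toLp_congr _ _ (.of_forall fun y => by simp [smul_comm c])
  norm_map' x := by
    change ‖(memLp_hermiteF_smul ν x).toLp _‖ = ‖x‖
    rw [← sq_eq_sq₀ (norm_nonneg _) (norm_nonneg _), ← real_inner_self_eq_norm_sq,
      inner_hermiteF_smul, if_pos rfl, real_inner_self_eq_norm_sq]

theorem orthogonalFamily_hermiteEmbedding :
    OrthogonalFamily ℝ (fun _ : ℕ →₀ ℕ => G) hermiteEmbedding := by
  intro ν μ h x x'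
  exact (inner_hermiteF_smul ν μ x x').trans (if_neg h)

variable [CompleteSpace G]

theorem isHilbertSum_hermiteEmbedding :
    IsHilbertSum ℝ (fun _ : ℕ →₀ ℕ => G) hermiteEmbedding := by
  refine IsHilbertSum.mk orthogonalFamily_hermiteEmbedding ?_
  rw [top_le_iff, Submodule.topologicalClosure_eq_top_iff, Submodule.eq_bot_iff]
  intro w hw
  have key : ∀ (ν : ℕ →₀ ℕ) (x : G), ∫ y, HeF ν y * inner ℝ x (w y) ∂gaussianMeasure = 0 := by
    intro ν x
    have h1 : inner ℝ (hermiteEmbedding ν x) w = 0 := by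
      refine (Submodule.mem_orthogonal _ _).1 hw _ ?_
      exact (le_iSup (fun ν : ℕ →₀ ℕ => LinearMap.range
        (hermiteEmbedding (G := G) ν).toLinearMap) ν) ⟨x, rfl⟩
    rw [L2.inner_def] at h1
    have h2 : ∀ᵐ y ∂gaussianMeasure, inner ℝ (hermiteEmbedding ν x y) (w y) =
        (Real.sqrt (factorialF ν))⁻¹ * (HeF ν y * inner ℝ x (w y)) := by
      filter_upwards [(memLp_hermiteF_smul ν x).coeFn_toLp] with y hy
      change inner ℝ ((memLp_hermiteF_smul ν x).toLp _ y) (w y) = _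
      rw [hy, real_inner_smul_left, hermiteF_eq, mul_assoc]
    rw [integral_congr_ae h2, integral_const_mul] at h1
    refine (mul_eq_zero.1 h1).resolve_left ?_
    exact (inv_pos.2 (Real.sqrt_pos.2 (factorialF_pos ν))).ne'
  have := ae_eq_zero_of_integral_HeF_eq_zero (Lp.memLp w) key
  exact (Lp.eq_zero_iff_ae_eq_zero).2 this

/-- Parseval: the mean square error of a truncated Hermite series is the sum of the squared norms of
the discarded coefficients. -/
theorem hasSum_norm_sq_hermite_residual {u : (ℕ → ℝ) → G} (hu : MemLp u 2 gaussianMeasure)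
    (Λ : Finset (ℕ →₀ ℕ)) :
    HasSum (fun ν : ℕ →₀ ℕ => if ν ∈ Λ then 0 else
        ‖∫ y, hermiteF ν y • u y ∂gaussianMeasure‖ ^ 2)
      ((eLpNorm (fun y => u y - ∑ ν ∈ Λ, hermiteF ν y •
        ∫ z, hermiteF ν z • u z ∂gaussianMeasure) 2 gaussianMeasure).toReal ^ 2) := by
  set c : (ℕ →₀ ℕ) → G := fun ν => ∫ y, hermiteF ν y • u y ∂gaussianMeasure with hc
  have hui : ∀ ν, Integrable (fun y => hermiteF ν y • u y) gaussianMeasure := fun ν =>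
    memLp_one_iff_integrable.1 (hu.smul (memLp_hermiteF ν))
  set U : Lp G 2 gaussianMeasure := hu.toLp _
  set r : Lp G 2 gaussianMeasure := U - ∑ ν ∈ Λ, hermiteEmbedding ν (c ν) with hr
  have hH := isHilbertSum_hermiteEmbedding (G := G)
  -- the coordinates of the residual
  have hUinner : ∀ ν x, inner ℝ (hermiteEmbedding ν x) U = inner ℝ x (c ν) := by
    intro ν x
    rw [L2.inner_def, hc, ← integral_inner (hui ν)]
    refine integral_congr_ae ?_
    filter_upwards [(memLp_hermiteF_smul ν x).coeFn_toLp, hu.coeFn_toLp] with y h1 h2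
    change inner ℝ ((memLp_hermiteF_smul ν x).toLp _ y) (hu.toLp _ y) = _
    rw [h1, h2, real_inner_smul_left, real_inner_smul_right]
  have hrinner : ∀ ν x, inner ℝ (hermiteEmbedding ν x) r =
      inner ℝ x (if ν ∈ Λ then 0 else c ν) := by
    intro ν x
    have h1 : ∀ μ, inner ℝ (hermiteEmbedding ν x) (hermiteEmbedding μ (c μ)) =
        if ν = μ then inner ℝ x (c μ) else 0 := fun μ => inner_hermiteF_smul ν μ x (c μ)
    rw [hr, inner_sub_right, inner_sum, hUinner]
    simp_rw [h1]
    rw [Finset.sum_ite_eq]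
    split_ifs <;> simp
  set a : lp (fun _ : ℕ →₀ ℕ => G) 2 := hH.linearIsometryEquiv r
  have hcoord : ∀ ν, a ν = if ν ∈ Λ then 0 else c ν := by
    intro ν
    classical
    refine ext_inner_left ℝ fun x => ?_
    have h1 : inner ℝ x (a ν) = inner ℝ (lp.single 2 ν x) a :=
      (lp.inner_single_left (𝕜 := ℝ) (G := fun _ : ℕ →₀ ℕ => G) ν x a).symm
    refine h1.trans ?_
    rw [← hrinner, ← hH.linearIsometryEquiv_symm_apply_single,
      ← hH.linearIsometryEquiv.inner_map_map, LinearIsometryEquiv.apply_symm_apply]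
  have hnorm : HasSum (fun ν => ‖a ν‖ ^ 2) (‖a‖ ^ 2) := by
    have := lp.hasSum_norm (p := 2) (by norm_num) a
    simpa using this
  have h2 : ‖a‖ = (eLpNorm (fun y => u y - ∑ ν ∈ Λ, hermiteF ν y • c ν) 2
      gaussianMeasure).toReal := by
    rw [LinearIsometryEquiv.norm_map, Lp.norm_def]
    congr 1
    refine eLpNorm_congr_ae ?_
    have hsum : (∑ ν ∈ Λ, hermiteEmbedding ν (c ν) : Lp G 2 gaussianMeasure) =ᵐ[gaussianMeasure]
        fun y => ∑ ν ∈ Λ, hermiteF ν y • c ν := by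
      refine (Lp.coeFn_finsetSum _ _).trans ?_
      have : ∀ᵐ y ∂gaussianMeasure, ∀ ν ∈ Λ, hermiteEmbedding ν (c ν) y = hermiteF ν y • c ν := by
        rw [Finset.eventually_all]
        intro ν _
        exact (memLp_hermiteF_smul ν (c ν)).coeFn_toLp
      filter_upwards [this] with y hy
      rw [Finset.sum_apply]
      exact Finset.sum_congr rfl hy
    filter_upwards [Lp.coeFn_sub U (∑ ν ∈ Λ, hermiteEmbedding ν (c ν)), hsum,
      hu.coeFn_toLp] with y h1 h2 h3
    rw [hr, h1, Pi.sub_apply, h2, h3]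
  rw [← h2]
  convert hnorm using 2 with ν
  rw [hcoord]; split_ifs <;> simp [hc]

end Parseval

end LognormalPDE

/-! ### Sums over finitely supported multi-indices -/

namespace LognormalPDE

/-- A product family is summable over the finitely supported multi-indices as soon as the
one-dimensional sums are `≤ exp(η_j)` with `∑ η_j < ∞`. -/
theorem sum_finsupp_prod_le_exp (g : ℕ → ℕ → ℝ) (hg : ∀ j n, 0 ≤ g j n) (hg0 : ∀ j, g j 0 = 1)
    {η : ℕ → ℝ} (hη : Summable η) (hs : ∀ j N, ∑ n ∈ Finset.range N, g j n ≤ Real.exp (η j))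
    (S : Finset (ℕ →₀ ℕ)) :
    ∑ ν ∈ S, ∏ j ∈ ν.support, g j (ν j) ≤ Real.exp (∑' j, η j) := by
  classical
  have hη0 : ∀ j, 0 ≤ η j := fun j => by
    have := hs j 1
    rw [Finset.sum_range_one, hg0] at this
    exact Real.one_le_exp_iff.1 this
  set I : Finset ℕ := S.biUnion fun ν => ν.support
  set N : ℕ := (S.sup fun ν => I.sup ν) + 1
  have hsupp : ∀ ν ∈ S, ν.support ⊆ I := fun ν hν =>
    Finset.subset_biUnion_of_mem (fun ν : ℕ →₀ ℕ => ν.support) hν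
  let r : (ℕ →₀ ℕ) → (∀ j ∈ I, ℕ) := fun ν j _ => ν j
  have hinj : Set.InjOn r S := by
    intro ν hν μ hμ h
    ext j
    by_cases hj : j ∈ I
    · exact congrFun (congrFun h j) hj
    · rw [Finsupp.notMem_support_iff.1 fun h => hj (hsupp ν hν h),
        Finsupp.notMem_support_iff.1 fun h => hj (hsupp μ hμ h)]
  calc ∑ ν ∈ S, ∏ j ∈ ν.support, g j (ν j)
      = ∑ ν ∈ S, ∏ x ∈ I.attach, g x.1 (r ν x.1 x.2) := by
        refine Finset.sum_congr rfl fun ν hν => ?_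
        rw [Finset.prod_subset (hsupp ν hν) fun j _ hj => by
          rw [Finsupp.notMem_support_iff.1 hj, hg0]]
        exact (Finset.prod_attach I fun j => g j (ν j)).symm
    _ = ∑ p ∈ S.image r, ∏ x ∈ I.attach, g x.1 (p x.1 x.2) :=
        (Finset.sum_image (f := fun p : (∀ j ∈ I, ℕ) => ∏ x ∈ I.attach, g x.1 (p x.1 x.2))
          hinj).symm
    _ ≤ ∑ p ∈ I.pi fun _ => Finset.range N, ∏ x ∈ I.attach, g x.1 (p x.1 x.2) := by
        refine Finset.sum_le_sum_of_subset_of_nonneg ?_ fun p _ _ =>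
          Finset.prod_nonneg fun _ _ => hg _ _
        intro p hp
        obtain ⟨ν, hν, rfl⟩ := Finset.mem_image.1 hp
        refine Finset.mem_pi.2 fun j hj => Finset.mem_range.2 (Nat.lt_succ_of_le ?_)
        exact (Finset.le_sup (f := ν) hj).trans
          (Finset.le_sup (f := fun ν : ℕ →₀ ℕ => I.sup ν) hν)
    _ = ∏ j ∈ I, ∑ n ∈ Finset.range N, g j n := (Finset.prod_sum _ _ _).symm
    _ ≤ ∏ j ∈ I, Real.exp (η j) := Finset.prod_le_prod
        (fun j _ => Finset.sum_nonneg fun _ _ => hg _ _) fun j _ => hs j N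
    _ = Real.exp (∑ j ∈ I, η j) := (Real.exp_sum _ _).symm
    _ ≤ _ := Real.exp_le_exp.2 (hη.sum_le_tsum I fun j _ => hη0 j)

/-- `|ν ∧ r| = ∑_j min(ν_j, r)`. -/
def truncDegree (r : ℕ) (ν : ℕ →₀ ℕ) : ℕ := ∑ j ∈ ν.support, min (ν j) r

theorem pow_min_le_factorial_mul {x : ℝ} (hx : 0 ≤ x) {n r : ℕ} (hn : n ≠ 0) (hr : r ≠ 0) :
    x ^ min n r ≤ r.factorial * (Real.exp x - 1) := by
  set m := min n r
  have hm0 : m ≠ 0 := by omega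
  have h1 := Real.sum_le_exp_of_nonneg hx (m + 1)
  rw [Finset.sum_range_succ] at h1
  have h2 : (1 : ℝ) ≤ ∑ i ∈ Finset.range m, x ^ i / (i.factorial : ℝ) := by
    have := Finset.single_le_sum (f := fun i => x ^ i / (i.factorial : ℝ))
      (fun i _ => by positivity) (Finset.mem_range.2 (Nat.pos_of_ne_zero hm0))
    simpa using this
  have h3 : x ^ m / (m.factorial : ℝ) ≤ Real.exp x - 1 := by linarith
  rw [div_le_iff₀ (by positivity)] at h3
  refine h3.trans ?_
  rw [mul_comm]
  have h4 : 0 ≤ Real.exp x - 1 := by linarith [Real.add_one_le_exp x]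
  gcongr
  exact min_le_right _ _

/-- If `∑ c_j` is small, the family `|ν ∧ r|! ∏_j c_j^{ν_j ∧ r} w(ν_j)` is summable.  The factorial
is written as a Gamma integral, which turns the sum into an integral of product families. -/
theorem summable_factorial_mul_prod {r : ℕ} (hr : r ≠ 0) {w : ℕ → ℝ} (hw : ∀ n, 0 ≤ w n)
    (hw0 : w 0 = 1) (hws : Summable w) {c : ℕ → ℝ} (hc : ∀ j, 0 ≤ c j) (hcs : Summable c)
    (hsmall : (r.factorial * ∑' n, w n) * ∑' j, c j ≤ 1 / 2) :
    Summable fun ν : ℕ →₀ ℕ => ((truncDegree r ν).factorial : ℝ) *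
      ∏ j ∈ ν.support, (c j ^ min (ν j) r * w (ν j)) := by
  set K : ℝ := r.factorial * ∑' n, w n with hK
  have hw1 : 1 ≤ ∑' n, w n := hw0 ▸ hws.le_tsum 0 fun n _ => hw n
  have hr1 : (1 : ℝ) ≤ r.factorial := by exact_mod_cast Nat.one_le_iff_ne_zero.2 r.factorial_ne_zero
  have hK1 : 1 ≤ K := by nlinarith
  have hterm : ∀ ν : ℕ →₀ ℕ, 0 ≤ ∏ j ∈ ν.support, (c j ^ min (ν j) r * w (ν j)) := fun ν =>
    Finset.prod_nonneg fun j _ => mul_nonneg (pow_nonneg (hc j) _) (hw _)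
  refine summable_of_sum_le (c := 2) (fun ν => mul_nonneg (by positivity) (hterm ν)) fun S => ?_
  have hGamma : ∀ k : ℕ, ∫ s in Set.Ioi (0 : ℝ), Real.exp (-s) * s ^ k = k.factorial := by
    intro k
    rw [← Real.Gamma_nat_eq_factorial, Real.Gamma_eq_integral (by positivity)]
    refine setIntegral_congr_fun measurableSet_Ioi fun s _ => ?_
    simp
  have hGint : ∀ k : ℕ, IntegrableOn (fun s : ℝ => Real.exp (-s) * s ^ k) (Set.Ioi 0) := by
    intro k
    refine (Real.GammaIntegral_convergent (s := k + 1) (by positivity)).congr_fun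
      (fun s _ => ?_) measurableSet_Ioi
    simp
  -- the sum for a fixed value of the integration variable
  have hbound : ∀ s : ℝ, 0 ≤ s → ∑ ν ∈ S, s ^ truncDegree r ν *
      ∏ j ∈ ν.support, (c j ^ min (ν j) r * w (ν j)) ≤ Real.exp (s / 2) := by
    intro s hs
    have h1 := sum_finsupp_prod_le_exp (fun j n => (s * c j) ^ min n r * w n)
      (fun j n => mul_nonneg (pow_nonneg (mul_nonneg hs (hc j)) _) (hw n)) (by simp [hw0])
      (η := fun j => K * (s * c j)) ((hcs.mul_left s).mul_left K) (fun j N => ?_) S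
    · refine le_trans (le_of_eq ?_) (h1.trans (Real.exp_le_exp.2 ?_))
      · refine Finset.sum_congr rfl fun ν _ => ?_
        rw [truncDegree, ← Finset.prod_pow_eq_pow_sum, ← Finset.prod_mul_distrib]
        exact Finset.prod_congr rfl fun j _ => by rw [mul_pow, mul_assoc]
      · rw [tsum_mul_left, tsum_mul_left]
        nlinarith
    · set x := s * c j
      have hx : 0 ≤ x := mul_nonneg hs (hc j)
      have he : 0 ≤ Real.exp x - 1 := by linarith [Real.add_one_le_exp x]
      have h2 : ∑ n ∈ Finset.range N, x ^ min n r * w n ≤ 1 + K * (Real.exp x - 1) := by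
        calc ∑ n ∈ Finset.range N, x ^ min n r * w n
            ≤ ∑ n ∈ Finset.range N, ((if n = 0 then 1 else 0) +
                r.factorial * (Real.exp x - 1) * w n) := by
              refine Finset.sum_le_sum fun n _ => ?_
              split_ifs with hn
              · subst hn
                simp only [Nat.zero_min, pow_zero, hw0, mul_one]
                nlinarith
              · rw [zero_add]
                exact mul_le_mul_of_nonneg_right (pow_min_le_factorial_mul hx hn hr) (hw n)
          _ ≤ 1 + r.factorial * (Real.exp x - 1) * ∑' n, w n := by
              rw [Finset.sum_add_distrib, ← Finset.mul_sum]
              gcongr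
              · rw [Finset.sum_ite_eq']
                split_ifs <;> norm_num
              · exact hws.sum_le_tsum _ fun n _ => hw n
          _ = _ := by rw [hK]; ring
      refine h2.trans ?_
      -- Bernoulli: `1 + K (e^x - 1) ≤ (e^x)^K`
      have h3 := one_add_mul_self_le_rpow_one_add (s := Real.exp x - 1) (by linarith) hK1
      rw [add_sub_cancel, ← Real.exp_mul, mul_comm x] at h3
      exact h3
  have hsplit : ∑ ν ∈ S, ((truncDegree r ν).factorial : ℝ) *
      ∏ j ∈ ν.support, (c j ^ min (ν j) r * w (ν j)) =
      ∫ s in Set.Ioi (0 : ℝ), ∑ ν ∈ S, (Real.exp (-s) * s ^ truncDegree r ν) *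
        ∏ j ∈ ν.support, (c j ^ min (ν j) r * w (ν j)) := by
    rw [integral_finsetSum _ fun ν _ => (hGint _).mul_const _]
    refine Finset.sum_congr rfl fun ν _ => ?_
    rw [integral_mul_const, hGamma]
  have hexp : IntegrableOn (fun s : ℝ => Real.exp (-(1 / 2) * s)) (Set.Ioi 0) :=
    integrableOn_exp_mul_Ioi (by norm_num) 0
  rw [hsplit]
  calc _ ≤ ∫ s in Set.Ioi (0 : ℝ), Real.exp (-(1 / 2) * s) := by
        refine setIntegral_mono_on (integrable_finsetSum _ fun ν _ => (hGint _).mul_const _)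
          hexp measurableSet_Ioi fun s hs => ?_
        simp_rw [mul_assoc]
        rw [← Finset.mul_sum]
        calc _ ≤ Real.exp (-s) * Real.exp (s / 2) := by
              gcongr
              exact hbound s (le_of_lt hs)
          _ = _ := by rw [← Real.exp_add]; ring_nf
    _ = 2 := by rw [integral_exp_mul_Ioi (by norm_num) 0]; norm_num

/-- `(n - n ∧ r)! / n!`. -/
noncomputable def factorialRatio (r n : ℕ) : ℝ := ((n.descFactorial (min n r) : ℕ) : ℝ)⁻¹

theorem descFactorial_min_pos (r n : ℕ) : 0 < n.descFactorial (min n r) :=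
  Nat.descFactorial_pos.2 (min_le_left _ _)

theorem factorialRatio_pos (r n : ℕ) : 0 < factorialRatio r n :=
  inv_pos.2 (by exact_mod_cast descFactorial_min_pos r n)

theorem factorialRatio_zero (r : ℕ) : factorialRatio r 0 = 1 := by simp [factorialRatio]

theorem factorialRatio_le {r n : ℕ} (hr : r ≠ 0) (hn : n ≠ 0) :
    factorialRatio r n ≤ ((r : ℝ) / n) ^ r := by
  have hr0 : (0 : ℝ) < r := by exact_mod_cast Nat.pos_of_ne_zero hr
  have hn0 : (0 : ℝ) < n := by exact_mod_cast Nat.pos_of_ne_zero hn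
  rw [factorialRatio, inv_le_comm₀ (by exact_mod_cast descFactorial_min_pos r n) (by positivity),
    ← inv_pow, inv_div]
  rcases le_total n r with h | h
  · calc ((n : ℝ) / r) ^ r ≤ 1 :=
          pow_le_one₀ (by positivity) ((div_le_one hr0).2 (by exact_mod_cast h))
      _ ≤ _ := by exact_mod_cast descFactorial_min_pos r n
  · rw [min_eq_right h]
    calc ((n : ℝ) / r) ^ r ≤ ((n + 1 - r : ℕ) : ℝ) ^ r := by
          gcongr
          rw [div_le_iff₀ hr0, Nat.cast_sub (by omega)]
          push_cast
          have h1 : (r : ℝ) ≤ n := by exact_mod_cast h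
          have h2 : (1 : ℝ) ≤ r := by exact_mod_cast Nat.pos_of_ne_zero hr
          nlinarith
      _ ≤ _ := by exact_mod_cast Nat.pow_sub_le_descFactorial n r

theorem summable_factorialRatio_rpow {r : ℕ} {e : ℝ} (he : 0 < e) (hre : 1 < r * e) :
    Summable fun n => factorialRatio r n ^ e := by
  have hr : r ≠ 0 := by rintro rfl; norm_num at hre
  have h1 : Summable fun n : ℕ => ((r : ℝ) ^ r) ^ e * ((n : ℝ) ^ (r * e))⁻¹ :=
    (Real.summable_nat_rpow_inv.2 hre).mul_left _
  refine Summable.of_norm_bounded_eventually_nat h1 ?_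
  filter_upwards [eventually_ne_atTop 0] with n hn
  rw [Real.norm_of_nonneg (Real.rpow_nonneg (factorialRatio_pos r n).le _)]
  refine (Real.rpow_le_rpow (factorialRatio_pos r n).le (factorialRatio_le hr hn) he.le).trans
    (le_of_eq ?_)
  rw [div_pow, Real.div_rpow (by positivity) (by positivity), div_eq_mul_inv, Real.rpow_mul
    (by positivity), Real.rpow_natCast]

/-- The bound for the Hermite coefficients obtained by integrating by parts `ν ∧ r` times. -/
noncomputable def coeffBound (r : ℕ) (a : ℕ → ℝ) (ν : ℕ →₀ ℕ) : ℝ :=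
  2 ^ truncDegree r ν * ((truncDegree r ν).factorial : ℝ) *
    ∏ j ∈ ν.support, (a j ^ min (ν j) r * Real.sqrt (factorialRatio r (ν j)))

theorem coeffBound_nonneg (r : ℕ) {a : ℕ → ℝ} (ha : ∀ j, 0 ≤ a j) (ν : ℕ →₀ ℕ) :
    0 ≤ coeffBound r a ν :=
  mul_nonneg (by positivity) (Finset.prod_nonneg fun j _ =>
    mul_nonneg (pow_nonneg (ha j) _) (Real.sqrt_nonneg _))

/-- Young's inequality without the constants. -/
theorem mul_le_rpow_add_rpow {x y P Q : ℝ} (hx : 0 ≤ x) (hy : 0 ≤ y) (h : P.HolderConjugate Q) :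
    x * y ≤ x ^ P + y ^ Q := by
  refine (Real.young_inequality_of_nonneg hx hy h).trans (add_le_add ?_ ?_)
  · exact div_le_self (Real.rpow_nonneg hx _) h.lt.le
  · exact div_le_self (Real.rpow_nonneg hy _) h.symm.lt.le

/-- The product family `∏_j σ_j^{ν_j ∧ r} w(ν_j)` is summable along with `σ` and `w`; no smallness
of `σ` is needed, as the powers of `σ_j` that occur are bounded. -/
theorem summable_prod_pow_min {r : ℕ} (hr : r ≠ 0) {w : ℕ → ℝ} (hw : ∀ n, 0 ≤ w n)
    (hw0 : w 0 = 1) (hws : Summable w) {σ : ℕ → ℝ} (hσ : ∀ j, 0 ≤ σ j) (hσs : Summable σ) :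
    Summable fun ν : ℕ →₀ ℕ => ∏ j ∈ ν.support, (σ j ^ min (ν j) r * w (ν j)) := by
  obtain ⟨B, hB⟩ : ∃ B, ∀ j, σ j ≤ B :=
    ⟨∑' j, σ j, fun j => hσs.le_tsum j fun i _ => hσ i⟩
  set D : ℝ := max 1 B
  have hD : 1 ≤ D := le_max_left _ _
  have hσD : ∀ j, σ j ≤ D := fun j => (hB j).trans (le_max_right _ _)
  have hpow : ∀ j n, n ≠ 0 → σ j ^ min n r ≤ D ^ r * σ j := by
    intro j n hn
    obtain ⟨m, hm⟩ : ∃ m, min n r = m + 1 := ⟨min n r - 1, by omega⟩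
    have hmr : m ≤ r := by omega
    rw [hm, pow_succ]
    have := hσ j
    gcongr
    exact (pow_le_pow_left₀ (hσ j) (hσD j) m).trans (pow_le_pow_right₀ hD hmr)
  refine summable_of_sum_le (c := Real.exp (∑' j, D ^ r * (∑' n, w n) * σ j))
    (fun ν => Finset.prod_nonneg fun j _ => mul_nonneg (pow_nonneg (hσ j) _) (hw _)) fun S =>
    sum_finsupp_prod_le_exp (fun j n => σ j ^ min n r * w n)
      (fun j n => mul_nonneg (pow_nonneg (hσ j) _) (hw n)) (by simp [hw0])
      (hσs.mul_left _) (fun j N => ?_) S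
  calc ∑ n ∈ Finset.range N, σ j ^ min n r * w n
      ≤ ∑ n ∈ Finset.range N, ((if n = 0 then 1 else 0) + D ^ r * σ j * w n) := by
        refine Finset.sum_le_sum fun n _ => ?_
        split_ifs with hn
        · subst hn
          have := mul_nonneg (mul_nonneg (pow_nonneg (zero_le_one.trans hD) r) (hσ j)) (hw 0)
          simp only [Nat.zero_min, pow_zero, one_mul]
          rw [hw0] at this ⊢
          linarith
        · rw [zero_add]
          exact mul_le_mul_of_nonneg_right (hpow j n hn) (hw n)
    _ ≤ 1 + D ^ r * σ j * ∑' n, w n := by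
        rw [Finset.sum_add_distrib, ← Finset.mul_sum]
        have := hσ j
        gcongr
        · rw [Finset.sum_ite_eq']
          split_ifs <;> norm_num
        · exact hws.sum_le_tsum _ fun n _ => hw n
    _ ≤ Real.exp (D ^ r * (∑' n, w n) * σ j) := by
        have := Real.add_one_le_exp (D ^ r * (∑' n, w n) * σ j)
        linarith [this]

/-- If `a ∈ ℓ^q` with `1/q = 1/p + 1/2`, then the coefficient bounds are in `ℓ^p` for large `r`.
With `c_j = δ a_j^q` and `σ_j = 2 a_j^{1-q} / δ`, so that `2 a = c σ`, the bound factors into a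
summable family (for small `δ`) and a product family in `ℓ^{2p/(2-p)}`. -/
theorem exists_summable_coeffBound {a : ℕ → ℝ} (ha : ∀ j, 0 ≤ a j) {p q : ℝ} (hp0 : 0 < p)
    (hp2 : p < 2) (hq : 1 / q = 1 / p + 1 / 2) (hs : Summable fun j => a j ^ q) :
    ∃ r, Summable fun ν => coeffBound r a ν ^ p := by
  have hq' : q = 2 * p / (2 + p) := by
    have : q = 1 / (1 / q) := by simp
    rw [this, hq]; field_simp
  have hq0 : 0 < q := by rw [hq']; positivity
  set e : ℝ := 2 * p / (2 - p) with he
  have hp2' : 0 < 2 - p := by linarith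
  have he0 : 0 < e := by rw [he]; positivity
  have heq : (1 - q) * e = q := by rw [hq', he]; field_simp; ring
  -- `r` is large enough for both families
  obtain ⟨r, hr⟩ := exists_nat_gt (4 + 4 / e)
  have h4e : 0 < 4 / e := by positivity
  have hr1 : 1 < r * (1 / 4 : ℝ) := by linarith
  have hr2 : 1 < r * (1 / 4 * e) := by
    have : 4 / e < r := by linarith
    rw [div_lt_iff₀ he0] at this
    linarith
  have hr0 : r ≠ 0 := by rintro rfl; norm_num at hr1
  set w : ℕ → ℝ := fun n => factorialRatio r n ^ (1 / 4 : ℝ) with hwdef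
  have hw : ∀ n, 0 ≤ w n := fun n => Real.rpow_nonneg (factorialRatio_pos r n).le _
  have hw0 : w 0 = 1 := by simp [hwdef, factorialRatio_zero]
  have hws : Summable w := summable_factorialRatio_rpow (by norm_num) hr1
  have hwe : Summable fun n => w n ^ e := by
    simp_rw [hwdef, ← Real.rpow_mul (factorialRatio_pos r _).le]
    exact summable_factorialRatio_rpow (by positivity) hr2
  -- one factor `w` for each of the two families
  have hww : ∀ n, Real.sqrt (factorialRatio r n) = w n * w n := by
    intro n
    rw [hwdef, ← Real.rpow_add (factorialRatio_pos r n), Real.sqrt_eq_rpow]; norm_num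
  set K : ℝ := (r.factorial * ∑' n, w n) * ∑' j, a j ^ q with hK
  have hK0 : 0 ≤ K := by
    have h1 : 0 ≤ ∑' n, w n := tsum_nonneg hw
    have h2 : 0 ≤ ∑' j, a j ^ q := tsum_nonneg fun j => Real.rpow_nonneg (ha j) _
    positivity
  set δ : ℝ := 1 / (2 * (K + 1)) with hδ
  have hδ0 : 0 < δ := by positivity
  set c : ℕ → ℝ := fun j => δ * a j ^ q with hcdef
  set σ : ℕ → ℝ := fun j => 2 / δ * a j ^ (1 - q) with hσdef
  have hc : ∀ j, 0 ≤ c j := fun j => mul_nonneg hδ0.le (Real.rpow_nonneg (ha j) _)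
  have hσ : ∀ j, 0 ≤ σ j := fun j => mul_nonneg (by positivity) (Real.rpow_nonneg (ha j) _)
  have hac : ∀ j, 2 * a j = c j * σ j := by
    intro j
    have h1 : a j ^ q * a j ^ (1 - q) = a j := by
      rw [← Real.rpow_add' (ha j) (by norm_num)]; simp
    calc 2 * a j = 2 * (a j ^ q * a j ^ (1 - q)) := by rw [h1]
      _ = _ := by rw [hcdef, hσdef]; field_simp
  -- the two families
  set X : (ℕ →₀ ℕ) → ℝ := fun ν => ((truncDegree r ν).factorial : ℝ) *
      ∏ j ∈ ν.support, (c j ^ min (ν j) r * w (ν j)) with hX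
  set Z : (ℕ →₀ ℕ) → ℝ := fun ν => ∏ j ∈ ν.support, (σ j ^ min (ν j) r * w (ν j)) with hZ
  have hX0 : ∀ ν, 0 ≤ X ν := fun ν => mul_nonneg (by positivity)
    (Finset.prod_nonneg fun j _ => mul_nonneg (pow_nonneg (hc j) _) (hw _))
  have hZ0 : ∀ ν, 0 ≤ Z ν := fun ν =>
    Finset.prod_nonneg fun j _ => mul_nonneg (pow_nonneg (hσ j) _) (hw _)
  have hXs : Summable X := by
    refine summable_factorial_mul_prod hr0 hw hw0 hws hc (hs.mul_left δ) ?_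
    rw [tsum_mul_left]
    calc _ = δ * K := by rw [hK]; ring
      _ ≤ 1 / 2 := by
        rw [hδ, div_mul_eq_mul_div, one_mul, div_le_div_iff₀ (by positivity) (by norm_num)]
        linarith
  have hZs : Summable fun ν => Z ν ^ e := by
    have h1 := summable_prod_pow_min hr0 (w := fun n => w n ^ e) (σ := fun j => σ j ^ e)
      (fun n => Real.rpow_nonneg (hw n) _) (by simp [hw0]) hwe
      (fun j => Real.rpow_nonneg (hσ j) _) (by
        simp_rw [hσdef, Real.mul_rpow (show (0 : ℝ) ≤ 2 / δ by positivity)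
          (Real.rpow_nonneg (ha _) _), ← Real.rpow_mul (ha _), heq]
        exact hs.mul_left _)
    refine h1.congr fun ν => ?_
    rw [hZ, ← Real.finsetProd_rpow _ _ fun j _ => mul_nonneg (pow_nonneg (hσ j) _) (hw _)]
    refine Finset.prod_congr rfl fun j _ => ?_
    rw [Real.mul_rpow (pow_nonneg (hσ j) _) (hw _), ← Real.rpow_natCast, ← Real.rpow_natCast,
      ← Real.rpow_mul (hσ j), ← Real.rpow_mul (hσ j), mul_comm e]
  have hprod : ∀ ν, coeffBound r a ν = X ν * Z ν := by
    intro ν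
    rw [coeffBound, hX, hZ, mul_comm (2 ^ _), mul_assoc, mul_assoc]
    congr 1
    rw [truncDegree, ← Finset.prod_pow_eq_pow_sum, ← Finset.prod_mul_distrib,
      ← Finset.prod_mul_distrib]
    refine Finset.prod_congr rfl fun j _ => ?_
    rw [hww, ← mul_assoc, ← mul_pow, hac, mul_pow]; ring
  have hX2 : Summable fun ν => X ν ^ (2 : ℝ) := by
    refine Summable.of_nonneg_of_le (fun ν => Real.rpow_nonneg (hX0 ν) _) (fun ν => ?_)
      (hXs.mul_left (∑' ν, X ν))
    rw [Real.rpow_two, sq]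
    exact mul_le_mul_of_nonneg_right (hXs.le_tsum ν fun μ _ => hX0 μ) (hX0 ν)
  have hconj : (2 / p).HolderConjugate (2 / (2 - p)) := by
    rw [Real.holderConjugate_iff]
    refine ⟨by rw [lt_div_iff₀ hp0]; linarith, ?_⟩
    field_simp; ring
  refine ⟨r, Summable.of_nonneg_of_le
    (fun ν => Real.rpow_nonneg (coeffBound_nonneg r ha ν) _) (fun ν => ?_) (hX2.add hZs)⟩
  rw [hprod, Real.mul_rpow (hX0 ν) (hZ0 ν)]
  refine (mul_le_rpow_add_rpow (Real.rpow_nonneg (hX0 ν) _) (Real.rpow_nonneg (hZ0 ν) _)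
    hconj).trans (le_of_eq ?_)
  rw [← Real.rpow_mul (hX0 ν), ← Real.rpow_mul (hZ0 ν)]
  congr 2
  · field_simp
  · rw [he]; ring

/-- The weighted condition `(j^β a_j) ∈ ℓ^p` with `β > 1/2` implies `a ∈ ℓ^q`, by Hölder. -/
theorem summable_rpow_of_weighted {a : ℕ → ℝ} (ha : ∀ j, 0 ≤ a j) {p q β : ℝ} (hp0 : 0 < p)
    (hq : 1 / q = 1 / p + 1 / 2) (hβ : 1 / 2 < β)
    (h : Summable fun j : ℕ => (((j : ℝ) + 1) ^ β * a j) ^ p) : Summable fun j => a j ^ q := by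
  have hq' : q = 2 * p / (2 + p) := by
    have : q = 1 / (1 / q) := by simp
    rw [this, hq]; field_simp
  have hq0 : 0 < q := by rw [hq']; positivity
  have hconj : (p / q).HolderConjugate (2 / q) := by
    rw [Real.holderConjugate_iff]
    constructor
    · rw [lt_div_iff₀ hq0, hq', one_mul, div_lt_iff₀ (by positivity)]; nlinarith
    · rw [hq']; field_simp
  have hsum : Summable fun j : ℕ => ((j : ℝ) + 1) ^ (-(2 * β)) := by
    have := (summable_nat_add_iff 1).2 (Real.summable_nat_rpow (p := -(2 * β)).2 (by linarith))
    simpa using this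
  refine Summable.of_nonneg_of_le (fun j => Real.rpow_nonneg (ha j) _) (fun j => ?_)
    (h.add hsum)
  have hj : (0 : ℝ) < (j : ℝ) + 1 := by positivity
  have h1 : a j ^ q = (((j : ℝ) + 1) ^ β * a j) ^ q * (((j : ℝ) + 1) ^ (-β)) ^ q := by
    rw [← Real.mul_rpow (mul_nonneg (by positivity) (ha j)) (by positivity), Real.rpow_neg hj.le]
    congr 1
    field_simp
  have hb : 0 ≤ ((j : ℝ) + 1) ^ β * a j := mul_nonneg (by positivity) (ha j)
  rw [h1]
  refine (mul_le_rpow_add_rpow (Real.rpow_nonneg hb _) (by positivity) hconj).trans (le_of_eq ?_)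
  rw [← Real.rpow_mul hb, ← Real.rpow_mul (by positivity), ← Real.rpow_mul hj.le]
  congr 2
  · field_simp
  · field_simp

/-! ### Best `n`-term approximation -/

section BestApproximation

variable {ι : Type*} {f : ι → ℝ} {p : ℝ}

/-- A family tending to zero has `n` largest entries. -/
theorem exists_finset_card_eq_largest [Infinite ι] (hf : ∀ i, 0 ≤ f i)
    (h : Tendsto f cofinite (𝓝 0)) (n : ℕ) :
    ∃ Λ : Finset ι, Λ.card = n ∧ ∀ i ∈ Λ, ∀ j ∉ Λ, f j ≤ f i := by
  classical
  induction n with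
  | zero => exact ⟨∅, by simp⟩
  | succ n ih =>
    obtain ⟨Λ, hΛ, hmax⟩ := ih
    obtain ⟨k, hk, hkmax⟩ : ∃ k ∉ Λ, ∀ j ∉ Λ, f j ≤ f k := by
      by_cases h0 : ∃ i ∉ Λ, 0 < f i
      · obtain ⟨i, hi, hfi⟩ := h0
        have hfin : {j | f i ≤ f j}.Finite := by
          have := h.eventually (gt_mem_nhds hfi)
          simpa [eventually_cofinite] using this
        set T : Finset ι := hfin.toFinset \ Λ
        have hiT : i ∈ T := by simp [T, hi]
        obtain ⟨k, hkT, hk⟩ := T.exists_max_image f ⟨i, hiT⟩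
        refine ⟨k, (Finset.mem_sdiff.1 hkT).2, fun j hj => ?_⟩
        by_cases hij : f i ≤ f j
        · exact hk j (by simp [T, hij, hj])
        · exact (not_le.1 hij).le.trans (hk i hiT)
      · push Not at h0
        obtain ⟨k, hk⟩ := Infinite.exists_notMem_finset Λ
        exact ⟨k, hk, fun j hj => (h0 j hj).trans (hf k)⟩
    refine ⟨insert k Λ, by rw [Finset.card_insert_of_notMem hk, hΛ], fun i hi j hj => ?_⟩
    rw [Finset.mem_insert, not_or] at hj
    rcases Finset.mem_insert.1 hi with rfl | hi
    · exact hkmax j hj.2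
    · exact hmax i hi j hj.2

theorem tendsto_cofinite_zero_of_summable_rpow (hp : 0 < p) (hf : ∀ i, 0 ≤ f i)
    (h : Summable fun i => f i ^ p) : Tendsto f cofinite (𝓝 0) := by
  have h1 := h.tendsto_cofinite_zero.rpow_const (p := p⁻¹) (Or.inr (inv_nonneg.2 hp.le))
  rw [Real.zero_rpow (inv_ne_zero hp.ne')] at h1
  refine h1.congr fun i => ?_
  rw [← Real.rpow_mul (hf i), mul_inv_cancel₀ hp.ne', Real.rpow_one]

/-- Stechkin's estimate for the `ℓ²` tail of a family in `ℓ^p`. -/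
theorem tsum_sq_le_of_largest (hp0 : 0 < p) (hp2 : p < 2) (hf : ∀ i, 0 ≤ f i)
    (h : Summable fun i => f i ^ p) {n : ℕ} {Λ : Finset ι} (hΛ : Λ.card = n)
    (hmax : ∀ i ∈ Λ, ∀ j ∉ Λ, f j ≤ f i) [DecidablePred (· ∈ Λ)] {R : ℝ}
    (hR : HasSum (fun i => if i ∈ Λ then 0 else f i ^ 2) (R ^ 2)) (hR0 : 0 ≤ R) :
    R ≤ (∑' i, f i ^ p) ^ (1 / p) * ((n : ℝ) + 1) ^ (-(1 / p - 1 / 2)) := by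
  classical
  set S := ∑' i, f i ^ p with hS
  have hfp : ∀ i, 0 ≤ f i ^ p := fun i => Real.rpow_nonneg (hf i) _
  have hS0 : 0 ≤ S := tsum_nonneg hfp
  have hn : (0 : ℝ) < (n : ℝ) + 1 := by positivity
  have hθ : 0 < 2 / p - 1 := by rw [sub_pos, lt_div_iff₀ hp0]; linarith
  -- an entry outside `Λ` is at most the `n + 1` entries of `insert j Λ`
  have htail : ∀ j ∉ Λ, f j ^ p ≤ S / (n + 1) := by
    intro j hj
    rw [le_div_iff₀ hn]
    calc f j ^ p * (n + 1) = ∑ i ∈ insert j Λ, f j ^ p := by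
          rw [Finset.sum_const, Finset.card_insert_of_notMem hj, hΛ, nsmul_eq_mul]; push_cast; ring
      _ ≤ ∑ i ∈ insert j Λ, f i ^ p := by
          refine Finset.sum_le_sum fun i hi => ?_
          rcases Finset.mem_insert.1 hi with rfl | hi
          · exact le_rfl
          · exact Real.rpow_le_rpow (hf j) (hmax i hi j hj) hp0.le
      _ ≤ S := h.sum_le_tsum _ fun i _ => hfp i
  have hterm : ∀ i, (if i ∈ Λ then 0 else f i ^ 2) ≤ f i ^ p * (S / (n + 1)) ^ (2 / p - 1) := by
    intro i
    split_ifs with hi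
    · exact mul_nonneg (hfp i) (Real.rpow_nonneg (div_nonneg hS0 hn.le) _)
    · calc f i ^ 2 = f i ^ p * (f i ^ p) ^ (2 / p - 1) := by
            rw [← Real.rpow_mul (hf i), ← Real.rpow_add' (hf i)]
            · rw [← Real.rpow_two]; congr 1; field_simp; ring
            · have : p + p * (2 / p - 1) = 2 := by field_simp; ring
              rw [this]; norm_num
        _ ≤ _ := mul_le_mul_of_nonneg_left
          (Real.rpow_le_rpow (hfp i) (htail i hi) hθ.le) (hfp i)
  have hle : R ^ 2 ≤ S * (S / (n + 1)) ^ (2 / p - 1) :=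
    hasSum_le hterm hR (h.hasSum.mul_right _)
  have hsq : S * (S / (n + 1)) ^ (2 / p - 1) =
      (S ^ (1 / p) * ((n : ℝ) + 1) ^ (-(1 / p - 1 / 2))) ^ 2 := by
    rw [Real.div_rpow hS0 hn.le, mul_pow, ← Real.rpow_natCast, ← Real.rpow_natCast,
      ← Real.rpow_mul hS0, ← Real.rpow_mul hn.le, div_eq_mul_inv, ← Real.rpow_neg hn.le,
      ← mul_assoc]
    congr 1
    · have h1 : S * S ^ (2 / p - 1) = S ^ (1 + (2 / p - 1)) := by
        rw [Real.rpow_add' hS0, Real.rpow_one]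
        rw [add_sub_cancel]; positivity
      rw [h1]; congr 1; push_cast; ring
    · congr 1; push_cast; ring
  rw [hsq] at hle
  refine (sq_le_sq₀ hR0 ?_).1 hle
  positivity

end BestApproximation

end LognormalPDE

/-! ### Exponential moments of the random coefficient -/

namespace LognormalPDE

/-- `E e^{t|s|} ≤ e^{K t}` for bounded `t`, with a linear exponent so that infinite products
converge. -/
theorem lintegral_exp_mul_abs_le {t B : ℝ} (ht : 0 ≤ t) (htB : t ≤ B) :
    ∫⁻ s, ENNReal.ofReal (Real.exp (t * |s|)) ∂gaussianReal 0 1 ≤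
      ENNReal.ofReal (Real.exp (t * ∫ s, |s| * Real.exp (B * |s|) ∂gaussianReal 0 1)) := by
  have hint : Integrable (fun s : ℝ => |s| * Real.exp (B * |s|)) (gaussianReal 0 1) := by
    have h : ExpBounded fun s : ℝ => |s| := by
      obtain ⟨C, c, h⟩ := expBounded_id
      exact ⟨C, c, by simpa using h⟩
    exact (h.mul (expBounded_exp_mul_abs B)).integrable (by fun_prop)
  rw [← ofReal_integral_eq_lintegral_ofReal (integrable_exp_mul_abs_gaussian t)
    (.of_forall fun s => (Real.exp_pos _).le)]
  refine ENNReal.ofReal_le_ofReal ?_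
  calc ∫ s, Real.exp (t * |s|) ∂gaussianReal 0 1
      ≤ ∫ s, (1 + t * (|s| * Real.exp (B * |s|))) ∂gaussianReal 0 1 := by
        refine integral_mono (integrable_exp_mul_abs_gaussian t)
          ((integrable_const 1).add (hint.const_mul t)) fun s => ?_
        -- `e^x ≤ 1 + x e^x`
        have h1 := Real.add_one_le_exp (-(t * |s|))
        have h2 : Real.exp (t * |s|) * Real.exp (-(t * |s|)) = 1 := by
          rw [← Real.exp_add]; simp
        have h3 : Real.exp (t * |s|) ≤ 1 + t * |s| * Real.exp (t * |s|) := by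
          nlinarith [Real.exp_pos (t * |s|)]
        have h4 : Real.exp (t * |s|) ≤ Real.exp (B * |s|) := by gcongr
        have h5 : t * |s| * Real.exp (t * |s|) ≤ t * |s| * Real.exp (B * |s|) := by gcongr
        simp only
        linarith
    _ = 1 + t * ∫ s, |s| * Real.exp (B * |s|) ∂gaussianReal 0 1 := by
        rw [integral_add (integrable_const 1) (hint.const_mul t), integral_const_mul]; simp
    _ ≤ _ := by
        have := Real.add_one_le_exp (t * ∫ s, |s| * Real.exp (B * |s|) ∂gaussianReal 0 1)
        linarith

section WeightedSum

variable {a : ℕ → ℝ}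

/-- Exponential moments of `∑_j |y_j| a_j`, stated for the supremum of the partial sums so that they
also give the almost sure convergence of the series. -/
theorem lintegral_iSup_exp_lt_top (ha : ∀ j, 0 ≤ a j) (hs : Summable a) {c : ℝ} (hc : 0 ≤ c) :
    ∫⁻ y : ℕ → ℝ, ⨆ J : ℕ,
      ENNReal.ofReal (Real.exp (c * ∑ j ∈ Finset.range J, |y j| * a j)) ∂gaussianMeasure < ⊤ := by
  have hcs : Summable fun j => c * a j := hs.mul_left c
  set B := ∑' j, c * a j
  set K := ∫ s, |s| * Real.exp (B * |s|) ∂gaussianReal 0 1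
  have hK : 0 ≤ K := integral_nonneg fun s => by positivity
  have hca : ∀ j, 0 ≤ c * a j := fun j => mul_nonneg hc (ha j)
  have hprod : ∀ (J : ℕ) (y : ℕ → ℝ),
      ENNReal.ofReal (Real.exp (c * ∑ j ∈ Finset.range J, |y j| * a j)) =
        ∏ j ∈ Finset.range J, ENNReal.ofReal (Real.exp (c * a j * |y j|)) := by
    intro J y
    rw [← ENNReal.ofReal_prod_of_nonneg fun _ _ => (Real.exp_pos _).le, ← Real.exp_sum,
      Finset.mul_sum]
    congr 2
    exact Finset.sum_congr rfl fun j _ => by ring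
  simp_rw [hprod]
  have hm : ∀ j, Measurable fun s : ℝ => ENNReal.ofReal (Real.exp (c * a j * |s|)) :=
    fun j => by fun_prop
  rw [lintegral_iSup]
  · refine lt_of_le_of_lt (iSup_le fun J => ?_)
      (ENNReal.ofReal_lt_top (r := Real.exp (B * K)))
    rw [lintegral_prod_gaussianMeasure _ (fun j s => ENNReal.ofReal (Real.exp (c * a j * |s|))) hm]
    calc _ ≤ ∏ j ∈ Finset.range J, ENNReal.ofReal (Real.exp (c * a j * K)) :=
          Finset.prod_le_prod' fun j _ =>
            lintegral_exp_mul_abs_le (hca j) (hcs.le_tsum j fun i _ => hca i)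
      _ = ENNReal.ofReal (Real.exp ((∑ j ∈ Finset.range J, c * a j) * K)) := by
          rw [← ENNReal.ofReal_prod_of_nonneg fun _ _ => (Real.exp_pos _).le, ← Real.exp_sum,
            Finset.sum_mul]
      _ ≤ _ := by
          gcongr
          exact hcs.sum_le_tsum _ fun j _ => hca j
  · exact fun J => Finset.measurable_prod _ fun j _ => (hm j).comp (measurable_pi_apply j)
  · refine monotone_nat_of_le_succ fun J y => ?_
    simp only
    rw [Finset.prod_range_succ]
    refine le_mul_of_one_le_right zero_le ?_
    rw [ENNReal.one_le_ofReal]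
    exact Real.one_le_exp (mul_nonneg (hca J) (abs_nonneg _))

theorem ae_summable_abs_mul (ha : ∀ j, 0 ≤ a j) (hs : Summable a) :
    ∀ᵐ y : ℕ → ℝ ∂gaussianMeasure, Summable fun j => |y j| * a j := by
  have h := lintegral_iSup_exp_lt_top ha hs zero_le_one
  have hm : Measurable fun y : ℕ → ℝ => ⨆ J : ℕ,
      ENNReal.ofReal (Real.exp (1 * ∑ j ∈ Finset.range J, |y j| * a j)) := by fun_prop
  filter_upwards [ae_lt_top hm h.ne] with y hy
  refine summable_of_sum_range_le (fun j => mul_nonneg (abs_nonneg _) (ha j))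
    (c := (⨆ J : ℕ, ENNReal.ofReal
      (Real.exp (1 * ∑ j ∈ Finset.range J, |y j| * a j))).toReal) fun J => ?_
  have h1 := (ENNReal.ofReal_le_iff_le_toReal hy.ne).1 (le_iSup (fun J : ℕ => ENNReal.ofReal
      (Real.exp (1 * ∑ j ∈ Finset.range J, |y j| * a j))) J)
  have h2 := Real.add_one_le_exp (1 * ∑ j ∈ Finset.range J, |y j| * a j)
  linarith

theorem measurable_exp_tsum (a : ℕ → ℝ) :
    Measurable fun y : ℕ → ℝ => Real.exp (∑' j, |y j| * a j) := by
  refine Real.measurable_exp.comp ?_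
  exact Measurable.tsum fun j => by fun_prop

theorem memLp_exp_tsum (ha : ∀ j, 0 ≤ a j) (hs : Summable a) :
    MemLp (fun y : ℕ → ℝ => Real.exp (∑' j, |y j| * a j)) 2 gaussianMeasure := by
  have hm := measurable_exp_tsum a
  rw [memLp_two_iff_integrable_sq hm.aestronglyMeasurable]
  refine ⟨(hm.pow_const 2).aestronglyMeasurable, ?_⟩
  refine lt_of_le_of_lt (lintegral_mono_ae ?_)
    (lintegral_iSup_exp_lt_top ha hs (c := 2) (by norm_num))
  filter_upwards [ae_summable_abs_mul ha hs] with y hy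
  rw [← ofReal_norm, Real.norm_of_nonneg (by positivity)]
  have h1 : Tendsto (fun J : ℕ => ENNReal.ofReal
      (Real.exp (2 * ∑ j ∈ Finset.range J, |y j| * a j))) atTop
      (𝓝 (ENNReal.ofReal (Real.exp (∑' j, |y j| * a j) ^ 2))) := by
    refine ENNReal.tendsto_ofReal ?_
    have : Real.exp (∑' j, |y j| * a j) ^ 2 = Real.exp (2 * ∑' j, |y j| * a j) := by
      rw [← Real.exp_nat_mul]; norm_num
    rw [this]
    exact (Real.continuous_exp.tendsto _).comp ((hy.hasSum.tendsto_sum_nat).const_mul 2)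
  exact le_of_tendsto' h1 fun J => le_iSup (fun J : ℕ => ENNReal.ofReal
      (Real.exp (2 * ∑ j ∈ Finset.range J, |y j| * a j))) J

theorem summable_abs_update_mul {y : ℕ → ℝ} (hy : Summable fun j => |y j| * a j) (j : ℕ) (s : ℝ) :
    Summable fun i => |Function.update y j s i| * a i := by
  refine (summable_congr_cofinite ?_).2 hy
  have : ({j}ᶜ : Set ℕ) ∈ cofinite := (Set.finite_singleton j).compl_mem_cofinite
  filter_upwards [this] with i hi
  rw [Function.update_of_ne (by simpa using hi)]

end WeightedSum

/-! ### The Hermite coefficients of words -/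

namespace LogAffineFamily

variable {V G L : Type*}
    [NormedAddCommGroup V] [InnerProductSpace ℝ V] [CompleteSpace V]
    [NormedAddCommGroup G] [InnerProductSpace ℝ G] [CompleteSpace G]
    [NormedAddCommGroup L] [NormedSpace ℝ L]
    (P : LogAffineFamily V G L) (ψ : ℕ → L)

/-- `b(y) = ∑_j y_j ψ_j`, as an unconditional sum. -/
noncomputable def logCoeff (ψ : ℕ → L) (y : ℕ → ℝ) : L := ∑' j, y j • ψ j

theorem summable_norm_smul_iff {y : ℕ → ℝ} :
    (Summable fun j => ‖y j • ψ j‖) ↔ Summable fun j => |y j| * ‖ψ j‖ := by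
  simp [norm_smul]

variable {ψ}

theorem norm_logCoeff_le {y : ℕ → ℝ} (hy : Summable fun j => |y j| * ‖ψ j‖) :
    ‖logCoeff ψ y‖ ≤ ∑' j, |y j| * ‖ψ j‖ := by
  refine (norm_tsum_le_tsum_norm ((summable_norm_smul_iff ψ).2 hy)).trans (le_of_eq ?_)
  simp [norm_smul]

/-- The dominating function for the vector `A(b(y))⁻¹ F`. -/
noncomputable def majorant (F : V) (ψ : ℕ → L) (y : ℕ → ℝ) : ℝ :=
  (P.c⁻¹) ^ 2 * ‖F‖ * Real.exp (∑' j, |y j| * ‖ψ j‖)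

theorem memLp_majorant (F : V) (hs : Summable fun j => ‖ψ j‖) :
    MemLp (P.majorant F ψ) 2 gaussianMeasure :=
  (memLp_exp_tsum (fun _ => norm_nonneg _) hs).const_mul _

theorem majorant_nonneg (F : V) (y : ℕ → ℝ) : 0 ≤ P.majorant F ψ y := by
  have := P.c_pos
  unfold majorant; positivity

theorem norm_word_logCoeff_le (F : V) {l : List (G →L[ℝ] G)} (hl : ∀ ζ ∈ l, P.IsLetter ζ)
    {y : ℕ → ℝ} (hy : Summable fun j => |y j| * ‖ψ j‖) :
    ‖P.word F (logCoeff ψ y) l‖ ≤ (l.map norm).prod * P.majorant F ψ y := by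
  refine (P.norm_word_le F _ l hl).trans ?_
  have h0 : 0 ≤ (l.map norm).prod := List.prod_nonneg (by simp)
  have := P.c_pos
  unfold majorant
  gcongr
  exact norm_logCoeff_le hy

/-- The `L²` norm of the majorant. -/
noncomputable def majorantNorm (F : V) (ψ : ℕ → L) : ℝ :=
  Real.sqrt (∫ y, P.majorant F ψ y ^ 2 ∂gaussianMeasure)

theorem norm_integral_HeF_smul_word_le (F : V) (hs : Summable fun j => ‖ψ j‖)
    {l : List (G →L[ℝ] G)} (hl : ∀ ζ ∈ l, P.IsLetter ζ) (ν : ℕ →₀ ℕ) :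
    ‖∫ y, HeF ν y • P.word F (logCoeff ψ y) l ∂gaussianMeasure‖ ≤
      (l.map norm).prod * P.majorantNorm F ψ * Real.sqrt (factorialF ν) := by
  have h0 : 0 ≤ (l.map norm).prod := List.prod_nonneg (by simp)
  have hM := P.memLp_majorant F hs
  have hI : Integrable (fun y => |HeF ν y| * P.majorant F ψ y) gaussianMeasure :=
    (memLp_HeF ν).norm.integrable_mul hM
  calc _ ≤ ∫ y, (l.map norm).prod * (|HeF ν y| * P.majorant F ψ y) ∂gaussianMeasure := by
        refine norm_integral_le_of_norm_le (hI.const_mul _) ?_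
        filter_upwards [ae_summable_abs_mul (fun j => norm_nonneg _) hs] with y hy
        rw [norm_smul, mul_left_comm, Real.norm_eq_abs]
        gcongr
        exact P.norm_word_logCoeff_le F hl hy
    _ = (l.map norm).prod * ∫ y, |HeF ν y| * P.majorant F ψ y ∂gaussianMeasure :=
        integral_const_mul _ _
    _ ≤ (l.map norm).prod * (Real.sqrt (factorialF ν) * P.majorantNorm F ψ) := by
        gcongr
        have h2 : (ENNReal.ofReal 2) = 2 := by norm_num
        have := integral_mul_le_Lp_mul_Lq_of_nonneg (μ := gaussianMeasure)
          (Real.HolderConjugate.two_two) (f := fun y => |HeF ν y|) (g := P.majorant F ψ)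
          (.of_forall fun y => abs_nonneg _) (.of_forall fun y => P.majorant_nonneg F y)
          (by rw [h2]; exact (memLp_HeF ν).norm) (by rw [h2]; exact hM)
        refine this.trans (le_of_eq ?_)
        rw [majorantNorm, Real.sqrt_eq_rpow, Real.sqrt_eq_rpow]
        congr 2
        · simp_rw [Real.rpow_two, sq_abs, sq]
          rw [integral_HeF_mul_HeF, if_pos rfl]
        · simp_rw [Real.rpow_two]
    _ = _ := by ring

variable [CompleteSpace L]

theorem hasSum_logCoeff {y : ℕ → ℝ} (hy : Summable fun j => |y j| * ‖ψ j‖) :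
    HasSum (fun j => y j • ψ j) (logCoeff ψ y) :=
  (((summable_norm_smul_iff ψ).2 hy).of_norm).hasSum

theorem logCoeff_update {y : ℕ → ℝ} (hy : Summable fun j => |y j| * ‖ψ j‖) (j : ℕ) (s : ℝ) :
    logCoeff ψ (Function.update y j s) = logCoeff ψ (Function.update y j 0) + s • ψ j := by
  have h1 := hasSum_logCoeff (summable_abs_update_mul hy j s)
  have h2 := (hasSum_logCoeff (summable_abs_update_mul hy j 0)).add (hasSum_ite_eq j (s • ψ j))
  refine h1.unique (h2.congr_fun fun i => ?_)
  by_cases hi : i = j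
  · subst hi; simp
  · simp [hi]

theorem aestronglyMeasurable_logCoeff (hs : Summable fun j => ‖ψ j‖) :
    AEStronglyMeasurable (logCoeff ψ) gaussianMeasure := by
  refine aestronglyMeasurable_of_tendsto_ae atTop
    (f := fun (J : ℕ) (y : ℕ → ℝ) => ∑ j ∈ Finset.range J, y j • ψ j) (fun J => ?_) ?_
  · refine Finset.aestronglyMeasurable_fun_sum _ fun j _ => ?_
    exact ((measurable_pi_apply j).stronglyMeasurable.smul_const (ψ j)).aestronglyMeasurable
  · filter_upwards [ae_summable_abs_mul (fun j => norm_nonneg _) hs] with y hy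
    exact (hasSum_logCoeff hy).tendsto_sum_nat

theorem memLp_word (F : V) (hs : Summable fun j => ‖ψ j‖) {l : List (G →L[ℝ] G)}
    (hl : ∀ ζ ∈ l, P.IsLetter ζ) :
    MemLp (fun y => P.word F (logCoeff ψ y) l) 2 gaussianMeasure := by
  refine ((P.memLp_majorant F hs).const_mul (l.map norm).prod).mono'
    ((P.continuous_word F l).comp_aestronglyMeasurable (aestronglyMeasurable_logCoeff hs)) ?_
  filter_upwards [ae_summable_abs_mul (fun j => norm_nonneg _) hs] with y hy
  exact P.norm_word_logCoeff_le F hl hy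

theorem integrable_HeF_smul_word (F : V) (hs : Summable fun j => ‖ψ j‖) {l : List (G →L[ℝ] G)}
    (hl : ∀ ζ ∈ l, P.IsLetter ζ) (ν : ℕ →₀ ℕ) :
    Integrable (fun y => HeF ν y • P.word F (logCoeff ψ y) l) gaussianMeasure :=
  memLp_one_iff_integrable.1 ((P.memLp_word F hs hl).smul (memLp_HeF ν))

/-- Integration by parts in one coordinate lowers the Hermite index and differentiates the word. -/
theorem integral_HeF_add_single_smul_word (F : V) (hs : Summable fun j => ‖ψ j‖)
    {l : List (G →L[ℝ] G)} (hl : ∀ ζ ∈ l, P.IsLetter ζ) (j : ℕ)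
    {W : List (ℝ × List (G →L[ℝ] G))} (hW : ∀ w ∈ W, ∀ ζ ∈ w.2, P.IsLetter ζ)
    (hd : ∀ (b : L) (t : ℝ), HasDerivAt (fun s : ℝ => P.word F (b + s • ψ j) l)
      ((W.map fun w => w.1 • P.word F (b + t • ψ j) w.2).sum) t) (ν : ℕ →₀ ℕ) :
    ∫ y, HeF (ν + Finsupp.single j 1) y • P.word F (logCoeff ψ y) l ∂gaussianMeasure =
      (W.map fun w => w.1 • ∫ y, HeF ν y • P.word F (logCoeff ψ y) w.2 ∂gaussianMeasure).sum := by
  have hsumI : ∀ W : List (ℝ × List (G →L[ℝ] G)), (∀ w ∈ W, ∀ ζ ∈ w.2, P.IsLetter ζ) →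
      Integrable (fun y => HeF ν y • (W.map fun w => w.1 • P.word F (logCoeff ψ y) w.2).sum)
        gaussianMeasure ∧
      ∫ y, HeF ν y • (W.map fun w => w.1 • P.word F (logCoeff ψ y) w.2).sum ∂gaussianMeasure =
      (W.map fun w => w.1 • ∫ y, HeF ν y • P.word F (logCoeff ψ y) w.2 ∂gaussianMeasure).sum := by
    intro W
    induction W with
    | nil => intro _; simp
    | cons w W ih =>
      intro hW
      obtain ⟨h1, h2⟩ := ih fun w' hw' => hW w' (by simp [hw'])
      have h3 := (P.integrable_HeF_smul_word F hs (hW w (by simp)) ν).smul w.1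
      simp only [List.map_cons, List.sum_cons, smul_add, smul_comm (HeF ν _) w.1]
      refine ⟨h3.add h1, ?_⟩
      have h4 := integral_add h3 h1
      simp only [Pi.smul_apply] at h4
      rw [h4, h2, integral_smul]
  obtain ⟨hI, hIe⟩ := hsumI W hW
  rw [← hIe, integral_gaussianMeasure_update (P.integrable_HeF_smul_word F hs hl _) j,
    integral_gaussianMeasure_update hI j]
  refine integral_congr_ae ?_
  filter_upwards [ae_summable_abs_mul (fun j => norm_nonneg _) hs] with y hy
  obtain ⟨b₀, hb₀⟩ : ∃ b₀, ∀ s, logCoeff ψ (Function.update y j s) = b₀ + s • ψ j :=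
    ⟨_, logCoeff_update hy j⟩
  have hexp : ∀ {l : List (G →L[ℝ] G)}, (∀ ζ ∈ l, P.IsLetter ζ) →
      ExpBounded fun s => P.word F (b₀ + s • ψ j) l := by
    intro l hl
    refine ⟨(l.map norm).prod * ((P.c⁻¹) ^ 2 * ‖F‖ * Real.exp ‖b₀‖), ‖ψ j‖, fun s => ?_⟩
    refine (P.norm_word_le F _ l hl).trans ?_
    have h0 : 0 ≤ (l.map norm).prod := List.prod_nonneg (by simp)
    have := P.c_pos
    rw [mul_assoc (l.map norm).prod, mul_assoc _ (Real.exp _), ← Real.exp_add]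
    gcongr
    refine (norm_add_le _ _).trans (le_of_eq ?_)
    rw [norm_smul, Real.norm_eq_abs, mul_comm]
  have hexpW : ∀ W : List (ℝ × List (G →L[ℝ] G)), (∀ w ∈ W, ∀ ζ ∈ w.2, P.IsLetter ζ) →
      ExpBounded fun s => (W.map fun w => w.1 • P.word F (b₀ + s • ψ j) w.2).sum := by
    intro W
    induction W with
    | nil => intro _; simpa using expBounded_const (0 : V)
    | cons w W ih =>
      intro hW
      simp only [List.map_cons, List.sum_cons]
      exact ((expBounded_const w.1).smul (hexp (hW w (by simp)))).add
        (ih fun w' hw' => hW w' (by simp [hw']))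
  have key := integral_He_succ_smul (hd b₀) (hexp hl) (hexpW W hW) (ν j)
  have herase : (ν + Finsupp.single j 1).erase j = ν.erase j := by
    ext i
    by_cases hi : i = j
    · subst hi; simp
    · simp [hi]
  simp_rw [HeF_update, hb₀, herase, mul_smul]
  rw [integral_smul, integral_smul]
  congr 1
  simpa using key

/-- Integrating by parts `|μ|` times.  Differentiating a word of length `m` gives at most
`2m + 1 ≤ 2 (m + 1)` words of length at most `m + 1`, so that at most
`2^{|μ|} (n + 1) ⋯ (n + |μ|)` words appear in the end. -/
theorem norm_integral_HeF_add_smul_word_le (F : V) (hs : Summable fun j => ‖ψ j‖) (k : ℕ)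
    (μ κ : ℕ →₀ ℕ) (hμ : μ.degree = k) (n : ℕ) (l : List (G →L[ℝ] G))
    (hl : ∀ ζ ∈ l, P.IsLetter ζ) (hn : l.length ≤ n) :
    ‖∫ y, HeF (κ + μ) y • P.word F (logCoeff ψ y) l ∂gaussianMeasure‖ ≤
      2 ^ k * ((n + 1).ascFactorial k : ℝ) * (μ.prod fun j m => ‖ψ j‖ ^ m) *
        ((l.map norm).prod * P.majorantNorm F ψ * Real.sqrt (factorialF κ)) := by
  induction k generalizing μ n l with
  | zero =>
    rw [Finsupp.degree_eq_zero_iff] at hμ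
    subst hμ
    simpa using P.norm_integral_HeF_smul_word_le F hs hl κ
  | succ k ih =>
    obtain ⟨j, hj⟩ : ∃ j, μ j ≠ 0 := by
      by_contra! h
      have : μ = 0 := Finsupp.ext h
      rw [this] at hμ
      simp at hμ
    obtain ⟨μ', rfl⟩ : ∃ μ', μ = μ' + Finsupp.single j 1 :=
      ⟨μ - Finsupp.single j 1, (tsub_add_cancel_of_le
        (Finsupp.single_le_iff.2 (Nat.one_le_iff_ne_zero.2 hj))).symm⟩
    have hμ' : μ'.degree = k := by
      rw [map_add, Finsupp.degree_single] at hμ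
      omega
    obtain ⟨W, hW1, hW2, hW3⟩ := P.exists_hasDerivAt_word F (ψ j) l hl
    rw [← add_assoc, P.integral_HeF_add_single_smul_word F hs hl j
      (fun w hw => (hW2 w hw).2.2.1) hW3]
    set Q : ℝ := 2 ^ k * ((n + 1 + 1).ascFactorial k : ℝ) * (μ'.prod fun j m => ‖ψ j‖ ^ m) *
      ((‖ψ j‖ * (l.map norm).prod) * P.majorantNorm F ψ * Real.sqrt (factorialF κ)) with hQ
    have hMn : 0 ≤ P.majorantNorm F ψ := Real.sqrt_nonneg _
    have hprod : 0 ≤ μ'.prod fun j m => ‖ψ j‖ ^ m :=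
      Finset.prod_nonneg fun _ _ => pow_nonneg (norm_nonneg _) _
    have hlp : 0 ≤ (l.map norm).prod := List.prod_nonneg (by simp)
    have hQ0 : 0 ≤ Q := by positivity
    have hterm : ∀ w ∈ W, ‖w.1 • ∫ y, HeF (κ + μ') y • P.word F (logCoeff ψ y) w.2
        ∂gaussianMeasure‖ ≤ Q := by
      intro w hw
      obtain ⟨h1, h2, h3, h4⟩ := hW2 w hw
      rw [norm_smul, Real.norm_eq_abs]
      refine (mul_le_of_le_one_left (norm_nonneg _) h1).trans ?_
      refine (ih μ' hμ' (n + 1) w.2 h3 (by omega)).trans ?_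
      rw [hQ]
      gcongr
    have hsum : ∀ W : List (ℝ × List (G →L[ℝ] G)), (∀ w ∈ W, ‖w.1 • ∫ y, HeF (κ + μ') y •
        P.word F (logCoeff ψ y) w.2 ∂gaussianMeasure‖ ≤ Q) →
        ‖(W.map fun w => w.1 • ∫ y, HeF (κ + μ') y • P.word F (logCoeff ψ y) w.2
          ∂gaussianMeasure).sum‖ ≤ W.length * Q := by
      intro W
      induction W with
      | nil => simp
      | cons w W ihW =>
        intro h
        simp only [List.map_cons, List.sum_cons, List.length_cons]
        refine (norm_add_le _ _).trans ?_
        have h1 := h w (by simp)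
        have h2 := ihW fun w' hw' => h w' (by simp [hw'])
        push_cast
        linarith
    refine (hsum W hterm).trans ?_
    have hWn : (W.length : ℝ) ≤ 2 * (n + 1) := by
      have : W.length ≤ 2 * (n + 1) := by omega
      exact_mod_cast this
    refine (mul_le_mul_of_nonneg_right hWn hQ0).trans (le_of_eq ?_)
    have hasc : (((n + 1).ascFactorial (k + 1) : ℕ) : ℝ) =
        ((n : ℝ) + 1) * ((n + 1 + 1).ascFactorial k : ℝ) := by
      rw [Nat.ascFactorial_succ, ← Nat.succ_ascFactorial]
      push_cast; ring
    rw [hasc, Finsupp.prod_add_index' (by simp) (by simp [pow_add]),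
      Finsupp.prod_single_index (by simp), hQ]
    ring

theorem factorialF_sub_div (r : ℕ) (ν : ℕ →₀ ℕ) {κ : ℕ →₀ ℕ}
    (hκ : ∀ j, κ j = ν j - min (ν j) r) :
    (Real.sqrt (factorialF ν))⁻¹ * Real.sqrt (factorialF κ) =
      ∏ j ∈ ν.support, Real.sqrt (factorialRatio r (ν j)) := by
  have hsupp : κ.support ⊆ ν.support := by
    intro j hj
    simp only [Finsupp.mem_support_iff, hκ] at hj ⊢
    omega
  rw [← Real.sqrt_inv, ← Real.sqrt_mul (inv_nonneg.2 (factorialF_pos ν).le),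
    ← Real.sqrt_prod _ fun j _ => (factorialRatio_pos r _).le, factorialF_eq_prod hsupp,
    factorialF, ← Finset.prod_inv_distrib, ← Finset.prod_mul_distrib]
  congr 1
  refine Finset.prod_congr rfl fun j _ => ?_
  have h := Nat.factorial_mul_descFactorial (min_le_left (ν j) r)
  have h1 : ((ν j).factorial : ℝ) = ((ν j - min (ν j) r).factorial : ℝ) *
      ((ν j).descFactorial (min (ν j) r) : ℝ) := by exact_mod_cast h.symm
  have h2 : ((ν j - min (ν j) r).factorial : ℝ) ≠ 0 := by positivity
  rw [hκ, factorialRatio, h1, mul_inv, mul_right_comm, inv_mul_cancel₀ h2, one_mul]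

/-- The bound for the Hermite coefficients of `y ↦ A(b(y))⁻¹ F`. -/
theorem norm_integral_hermiteF_smul_solve_le (F : V) (hs : Summable fun j => ‖ψ j‖) (r : ℕ)
    (ν : ℕ →₀ ℕ) :
    ‖∫ y, hermiteF ν y • P.solve (logCoeff ψ y) F ∂gaussianMeasure‖ ≤
      P.majorantNorm F ψ * coeffBound r (fun j => ‖ψ j‖) ν := by
  set μ : ℕ →₀ ℕ := ν.mapRange (fun n => min n r) (by simp) with hμ
  set κ : ℕ →₀ ℕ := ν.mapRange (fun n => n - min n r) (by simp) with hκ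
  have hsum : κ + μ = ν := by
    ext j; simp [hμ, hκ]
  have hsupp : μ.support ⊆ ν.support := Finsupp.support_mapRange
  have hdeg : μ.degree = truncDegree r ν := by
    rw [Finsupp.degree_apply, truncDegree]
    refine (Finset.sum_subset hsupp fun j _ hj => by simpa using hj).trans ?_
    simp [hμ]
  have hprod : (μ.prod fun j m => ‖ψ j‖ ^ m) = ∏ j ∈ ν.support, ‖ψ j‖ ^ min (ν j) r := by
    rw [Finsupp.prod_of_support_subset μ hsupp _ (by simp)]
    simp [hμ]
  have key := P.norm_integral_HeF_add_smul_word_le F hs _ μ κ hdeg 0 [] (by simp) (by simp)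
  rw [hsum] at key
  simp_rw [hermiteF_eq, mul_smul]
  rw [integral_smul, norm_smul, norm_inv, Real.norm_of_nonneg (Real.sqrt_nonneg _)]
  refine (mul_le_mul_of_nonneg_left key (by positivity)).trans (le_of_eq ?_)
  rw [coeffBound, Finset.prod_mul_distrib, ← factorialF_sub_div r ν (κ := κ) (by simp [hκ]), hprod]
  simp only [zero_add, Nat.one_ascFactorial, List.map_nil, List.prod_nil, one_mul]
  ring

end LogAffineFamily

end LognormalPDE

/-! ### The Poincaré inequality -/

namespace LognormalPDE

variable {d : ℕ} {D : Set (EuclideanSpace ℝ (Fin d))}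

theorem integrable_norm_sq_of_hasCompactSupport {E F : Type*} [NormedAddCommGroup E]
    [MeasurableSpace E] [BorelSpace E] (μ : Measure E) [IsFiniteMeasureOnCompacts μ]
    [NormedAddCommGroup F] {g : E → F} (hg : Continuous g) (hc : HasCompactSupport g) :
    Integrable (fun x => ‖g x‖ ^ 2) μ := by
  have hs : HasCompactSupport fun x => ‖g x‖ ^ 2 :=
    hc.comp_left (g := fun t : F => ‖t‖ ^ 2) (by simp)
  have hcont : Continuous fun x => ‖g x‖ ^ 2 := hg.norm.pow 2
  exact hcont.integrable_of_hasCompactSupport hs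

/-- Integration by parts against a linear form `ℓ` in a direction `e` with `ℓ e = 1`. -/
theorem integral_sq_eq_neg_integral_mul_fderiv {E : Type*} [NormedAddCommGroup E]
    [NormedSpace ℝ E] [FiniteDimensional ℝ E] [MeasurableSpace E] [BorelSpace E]
    (μ : Measure E) [μ.IsAddHaarMeasure] (ℓ : E →L[ℝ] ℝ) {e : E} (he : ℓ e = 1)
    {φ : E → ℝ} (hφ : ContDiff ℝ ∞ φ) (hc : HasCompactSupport φ) :
    Integrable (fun x => ℓ x * (2 * φ x * fderiv ℝ φ x e)) μ ∧
      ∫ x, φ x ^ 2 ∂μ = -∫ x, ℓ x * (2 * φ x * fderiv ℝ φ x e) ∂μ := by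
  have hdiff : Differentiable ℝ φ := hφ.differentiable (by simp)
  have hφc : Continuous φ := hφ.continuous
  have hgc : Continuous fun x => fderiv ℝ φ x e :=
    (hφ.continuous_fderiv (by simp)).clm_apply continuous_const
  have hsq : HasCompactSupport fun x => φ x ^ 2 :=
    hc.comp_left (g := fun t : ℝ => t ^ 2) (by simp)
  have hfsq : ∀ x, fderiv ℝ (fun x => φ x ^ 2) x e = 2 * φ x * fderiv ℝ φ x e := by
    intro x
    rw [((hdiff x).hasFDerivAt.pow 2).fderiv]
    simp
  have hIl : Integrable (fun x => ℓ x * (2 * φ x * fderiv ℝ φ x e)) μ := by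
    refine Continuous.integrable_of_hasCompactSupport
      (ℓ.continuous.mul ((continuous_const.mul hφc).mul hgc)) ?_
    have h1 : HasCompactSupport fun x => 2 * φ x := hc.mul_left (f := fun _ => (2 : ℝ))
    exact (h1.mul_right (f' := fun x => fderiv ℝ φ x e)).mul_left (f := fun x => ℓ x)
  have hone : ∀ x, fderiv ℝ (fun x => ℓ x) x e = 1 := fun x => by rw [ℓ.fderiv, he]
  have hparts := integral_mul_fderiv_eq_neg_fderiv_mul_of_integrable (μ := μ)
    (f := fun x => ℓ x) (g := fun x => φ x ^ 2) (v := e)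
    (by
      simp only [hone, one_mul]
      exact (hφc.pow 2).integrable_of_hasCompactSupport hsq)
    (by simpa only [hfsq] using hIl)
    ((ℓ.continuous.mul (hφc.pow 2)).integrable_of_hasCompactSupport
      (hsq.mul_left (f := fun x => ℓ x)))
    (fun x _ => ℓ.differentiableAt) (fun x _ => (hdiff x).pow 2)
  simp only [hfsq, hone, one_mul] at hparts
  exact ⟨hIl, by rw [hparts, neg_neg]⟩

/-- The Poincaré inequality for test functions supported in a ball of radius `R`, from
`∫ φ² = -∫ 2 x₁ φ ∂₁φ`. -/
theorem integral_sq_le_integral_gradient_sq (hd : 0 < d) {R : ℝ}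
    {φ : EuclideanSpace ℝ (Fin d) → ℝ} (hφ : ContDiff ℝ ∞ φ) (hc : HasCompactSupport φ)
    (hR : ∀ x, φ x ≠ 0 → ‖x‖ ≤ R) :
    ∫ x, φ x ^ 2 ≤ 4 * R ^ 2 * ∫ x, ‖gradient φ x‖ ^ 2 := by
  obtain ⟨e, hen⟩ : ∃ e : EuclideanSpace ℝ (Fin d), ‖e‖ = 1 :=
    ⟨EuclideanSpace.single ⟨0, hd⟩ 1, by simp⟩
  have hnorm : ∀ x, ‖gradient φ x‖ = ‖fderiv ℝ φ x‖ := fun x => by simp [gradient]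
  simp_rw [hnorm]
  have hI1 : Integrable fun x => φ x ^ 2 := by
    simpa using integrable_norm_sq_of_hasCompactSupport volume hφ.continuous hc
  have hI2 : Integrable fun x => ‖fderiv ℝ φ x‖ ^ 2 :=
    integrable_norm_sq_of_hasCompactSupport volume (hφ.continuous_fderiv (by simp)) (hc.fderiv ℝ)
  have hℓe : innerSL ℝ e e = 1 := by simp [hen]
  have hℓ : ∀ x, |innerSL ℝ e x| ≤ ‖x‖ := fun x => by
    simpa [hen] using abs_real_inner_le_norm e x
  generalize innerSL ℝ e = ℓ at hℓe hℓ
  obtain ⟨hIl, hparts⟩ := integral_sq_eq_neg_integral_mul_fderiv volume ℓ hℓe hφ hc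
  have hle : ∫ x, φ x ^ 2 ≤ ∫ x, (1 / 2 * φ x ^ 2 + 2 * R ^ 2 * ‖fderiv ℝ φ x‖ ^ 2) := by
    rw [hparts, ← integral_neg]
    refine integral_mono hIl.neg ((hI1.const_mul _).add (hI2.const_mul _)) fun x => ?_
    change -(ℓ x * (2 * φ x * fderiv ℝ φ x e)) ≤
      1 / 2 * φ x ^ 2 + 2 * R ^ 2 * ‖fderiv ℝ φ x‖ ^ 2
    by_cases h0 : φ x = 0
    · rw [h0]
      have : 0 ≤ R ^ 2 * ‖fderiv ℝ φ x‖ ^ 2 := by positivity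
      linarith
    · have hℓx : |ℓ x| ≤ R := (hℓ x).trans (hR x h0)
      have hder : |fderiv ℝ φ x e| ≤ ‖fderiv ℝ φ x‖ := by
        have := (fderiv ℝ φ x).le_opNorm e
        rwa [hen, mul_one] at this
      have h2 : |ℓ x * fderiv ℝ φ x e| ≤ R * ‖fderiv ℝ φ x‖ := by
        rw [abs_mul]
        exact mul_le_mul hℓx hder (abs_nonneg _) ((abs_nonneg _).trans hℓx)
      have h3 : (ℓ x * fderiv ℝ φ x e) ^ 2 ≤ (R * ‖fderiv ℝ φ x‖) ^ 2 :=
        sq_le_sq' (abs_le.1 h2).1 (abs_le.1 h2).2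
      have h4 := sq_nonneg (φ x + 2 * (ℓ x * fderiv ℝ φ x e))
      linarith
  rw [integral_add (hI1.const_mul _) (hI2.const_mul _), integral_const_mul,
    integral_const_mul] at hle
  linarith

theorem norm_sq_eq_integral {E : Type*} [NormedAddCommGroup E] [InnerProductSpace ℝ E]
    (g : Lp E 2 (vol D)) : ‖g‖ ^ 2 = ∫ x in D, ‖g x‖ ^ 2 := by
  rw [← real_inner_self_eq_norm_sq, L2.inner_def]
  simp

/-- The Poincaré inequality on `H¹₀(D)`, in terms of the full norm. -/
theorem exists_norm_le_norm_grad (hd : 0 < d) (hDb : Bornology.IsBounded D) :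
    ∃ c : ℝ, 0 < c ∧ ∀ v : H10 D, c * ‖v‖ ≤ ‖grad v‖ := by
  obtain ⟨R, hR⟩ := hDb.exists_norm_le
  set K : ℝ := 1 + 4 * R ^ 2 with hK
  have hK0 : 0 < K := by positivity
  have htest : ∀ w ∈ testPairs D, ‖w‖ ^ 2 ≤ K * ‖w.snd‖ ^ 2 := by
    rintro w ⟨φ, hφ, hc, hs, h1, h2⟩
    have hφD : ∀ x, x ∉ D → φ x = 0 := fun x hx =>
      image_eq_zero_of_notMem_tsupport fun h => hx (hs h)
    have hgD : ∀ x, x ∉ D → gradient φ x = 0 := fun x hx => by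
      have : fderiv ℝ φ x = 0 := by
        by_contra h
        exact hx (hs (support_fderiv_subset ℝ h))
      simp [gradient, this]
    have hP := integral_sq_le_integral_gradient_sq hd hφ hc (R := R) fun x hx =>
      hR x (by_contra fun h => hx (hφD x h))
    rw [WithLp.prod_norm_sq_eq_of_L2, norm_sq_eq_integral, norm_sq_eq_integral]
    have e1 : ∫ x in D, ‖w.fst x‖ ^ 2 = ∫ x, φ x ^ 2 := by
      refine Eq.trans (integral_congr_ae ?_)
        (setIntegral_eq_integral_of_forall_compl_eq_zero (s := D) fun x hx => by simp [hφD x hx])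
      filter_upwards [h1] with x hx
      rw [hx]; simp
    have e2 : ∫ x in D, ‖w.snd x‖ ^ 2 = ∫ x, ‖gradient φ x‖ ^ 2 := by
      refine Eq.trans (integral_congr_ae ?_)
        (setIntegral_eq_integral_of_forall_compl_eq_zero (s := D) fun x hx => by simp [hgD x hx])
      filter_upwards [h2] with x hx
      rw [hx]
    rw [e1, e2, hK]
    linarith
  have hall : ∀ v : H10 D, ‖v‖ ^ 2 ≤ K * ‖grad v‖ ^ 2 := by
    intro v
    have hclosed : IsClosed {w : Pairs D | ‖w‖ ^ 2 ≤ K * ‖w.snd‖ ^ 2} :=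
      isClosed_le (by fun_prop)
        (continuous_const.mul ((WithLp.sndL 2 ℝ _ _).continuous.norm.pow 2))
    exact closure_minimal htest hclosed v.2
  refine ⟨(Real.sqrt K)⁻¹, inv_pos.2 (Real.sqrt_pos.2 hK0), fun v => ?_⟩
  rw [inv_mul_le_iff₀ (Real.sqrt_pos.2 hK0)]
  refine (sq_le_sq₀ (norm_nonneg _) (by positivity)).1 ?_
  rw [mul_pow, Real.sq_sqrt hK0.le]
  exact hall v

/-! ### The lognormal diffusion equation as a log-affine family -/

/-- Multiplication of `L²` vector fields by an `L^∞` function. -/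
noncomputable def mulOp (D : Set (EuclideanSpace ℝ (Fin d))) :
    LInf D →L[ℝ] (Lp (EuclideanSpace ℝ (Fin d)) 2 (vol D) →L[ℝ]
      Lp (EuclideanSpace ℝ (Fin d)) 2 (vol D)) :=
  (ContinuousLinearMap.lsmul ℝ ℝ).holderL (vol D) ∞ 2 2

theorem coeFn_mulOp (b : LInf D) (g : Lp (EuclideanSpace ℝ (Fin d)) 2 (vol D)) :
    mulOp D b g =ᵐ[vol D] fun x => b x • g x :=
  ContinuousLinearMap.coeFn_holder (ContinuousLinearMap.lsmul ℝ ℝ) b g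

theorem norm_mulOp_le (b : LInf D) : ‖mulOp D b‖ ≤ ‖b‖ := by
  refine ContinuousLinearMap.opNorm_le_bound _ (norm_nonneg _) fun g => ?_
  refine (ContinuousLinearMap.norm_holder_apply_apply_le (ContinuousLinearMap.lsmul ℝ ℝ)
    b g).trans ?_
  gcongr
  exact mul_le_of_le_one_left (norm_nonneg _) ContinuousLinearMap.opNorm_lsmul_le

theorem commute_mulOp (a b : LInf D) : Commute (mulOp D a) (mulOp D b) := by
  refine ContinuousLinearMap.ext fun g => Lp.ext ?_
  change mulOp D a (mulOp D b g) =ᵐ[vol D] mulOp D b (mulOp D a g)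
  filter_upwards [coeFn_mulOp a (mulOp D b g), coeFn_mulOp b (mulOp D a g), coeFn_mulOp a g,
    coeFn_mulOp b g] with x h1 h2 h3 h4
  rw [h1, h2, h3, h4, smul_comm]

theorem isSelfAdjoint_mulOp (b : LInf D) : IsSelfAdjoint (mulOp D b) := by
  rw [ContinuousLinearMap.isSelfAdjoint_iff_isSymmetric]
  intro g g'
  change inner ℝ (mulOp D b g) g' = inner ℝ g (mulOp D b g')
  rw [L2.inner_def, L2.inner_def]
  refine integral_congr_ae ?_
  filter_upwards [coeFn_mulOp b g, coeFn_mulOp b g'] with x h1 h2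
  rw [h1, h2, real_inner_smul_left, real_inner_smul_right]

theorem coeFn_mulOp_pow (b : LInf D) (g : Lp (EuclideanSpace ℝ (Fin d)) 2 (vol D)) (n : ℕ) :
    (mulOp D b ^ n) g =ᵐ[vol D] fun x => b x ^ n • g x := by
  induction n with
  | zero => simp
  | succ n ih =>
    rw [pow_succ', mul_apply_eq_comp]
    filter_upwards [coeFn_mulOp b ((mulOp D b ^ n) g), ih] with x h1 h2
    rw [h1, h2, smul_smul, pow_succ']

/-- The operator exponential of the multiplication by `b` is the multiplication by `e^b`. -/
theorem coeFn_exp_mulOp (b : LInf D) (g : Lp (EuclideanSpace ℝ (Fin d)) 2 (vol D)) :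
    NormedSpace.exp (mulOp D b) g =ᵐ[vol D] fun x => Real.exp (b x) • g x := by
  have h1 : HasSum (fun n : ℕ => ((n.factorial : ℝ)⁻¹ • mulOp D b ^ n) g)
      (NormedSpace.exp (mulOp D b) g) :=
    (NormedSpace.exp_series_hasSum_exp' (𝕂 := ℝ) (mulOp D b)).mapL
      (ContinuousLinearMap.apply ℝ _ g)
  have h2 := h1.tendsto_sum_nat
  obtain ⟨N, hN, hlim⟩ := (tendstoInMeasure_of_tendsto_Lp h2).exists_seq_tendsto_ae
  have hpart : ∀ᵐ x ∂vol D, ∀ n : ℕ,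
      (∑ i ∈ Finset.range n, ((i.factorial : ℝ)⁻¹ • mulOp D b ^ i) g) x =
        ∑ i ∈ Finset.range n, ((i.factorial : ℝ)⁻¹ * b x ^ i) • g x := by
    rw [ae_all_iff]
    intro n
    have hterm : ∀ᵐ x ∂vol D, ∀ i : ℕ,
        (((i.factorial : ℝ)⁻¹ • mulOp D b ^ i) g) x = ((i.factorial : ℝ)⁻¹ * b x ^ i) • g x := by
      rw [ae_all_iff]
      intro i
      filter_upwards [Lp.coeFn_smul (i.factorial : ℝ)⁻¹ ((mulOp D b ^ i) g),
        coeFn_mulOp_pow b g i] with x h1 h2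
      rw [smul_apply, h1, Pi.smul_apply, h2, smul_smul]
    filter_upwards [hterm, Lp.coeFn_finsetSum (Finset.range n)
      (fun i => ((i.factorial : ℝ)⁻¹ • mulOp D b ^ i) g)] with x h1 h2
    rw [h2, Finset.sum_apply]
    exact Finset.sum_congr rfl fun i _ => h1 i
  filter_upwards [hlim, hpart] with x hx1 hx2
  have hs : HasSum (fun n : ℕ => ((n.factorial : ℝ)⁻¹) * b x ^ n) (Real.exp (b x)) := by
    have := NormedSpace.exp_series_hasSum_exp' (𝕂 := ℝ) (b x)
    rw [← Real.exp_eq_exp_ℝ] at this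
    simpa [smul_eq_mul] using this
  have h3 := ((hs.smul_const (g x)).tendsto_sum_nat).comp hN.tendsto_atTop
  refine tendsto_nhds_unique hx1 (h3.congr fun n => ?_)
  rw [Function.comp_apply, hx2]

/-- The gradient as a continuous linear map. -/
noncomputable def gradL (D : Set (EuclideanSpace ℝ (Fin d))) :
    H10 D →L[ℝ] Lp (EuclideanSpace ℝ (Fin d)) 2 (vol D) :=
  (WithLp.sndL 2 ℝ _ _).comp (testPairs D).topologicalClosure.subtypeL

theorem gradL_apply (v : H10 D) : gradL D v = grad v := rfl

instance : CompleteSpace (H10 D) :=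
  (testPairs D).isClosed_topologicalClosure.completeSpace_coe

/-- The operators `-div(e^b ∇ ·)` on `H¹₀(D)` as a log-affine family; `c` is a constant in the
Poincaré inequality. -/
noncomputable def diffusion {c : ℝ} (hc : 0 < c) (h : ∀ v : H10 D, c * ‖v‖ ≤ ‖grad v‖) :
    LogAffineFamily (H10 D) (Lp (EuclideanSpace ℝ (Fin d)) 2 (vol D)) (LInf D) where
  T := gradL D
  m := mulOp D
  c := c
  c_pos := hc
  lower_bound := h
  norm_m_le := norm_mulOp_le
  commute_m := commute_mulOp
  isSelfAdjoint_m := isSelfAdjoint_mulOp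

section Diffusion

variable {c : ℝ} (hc : 0 < c) (h : ∀ v : H10 D, c * ‖v‖ ≤ ‖grad v‖)

theorem inner_diffusion_form (b : LInf D) (w v : H10 D) :
    inner ℝ ((diffusion hc h).form 1 b w) v =
      ∫ x in D, Real.exp (b x) * inner ℝ (grad w x) (grad v x) := by
  rw [LogAffineFamily.inner_form, L2.inner_def]
  refine integral_congr_ae ?_
  filter_upwards [coeFn_exp_mulOp b (grad w)] with x hx
  change inner ℝ ((NormedSpace.exp (mulOp D b)) (grad w) x) (grad v x) = _
  rw [hx, real_inner_smul_left]

/-- The Riesz representative of `f ∈ H⁻¹(D)`. -/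
noncomputable def riesz (f : HNeg1 D) : H10 D := (InnerProductSpace.toDual ℝ (H10 D)).symm f

theorem isWeakSolution_iff (b : LInf D) (f : HNeg1 D) (w : H10 D) :
    IsWeakSolution b f w ↔ w = (diffusion hc h).solve b (riesz f) := by
  have h1 : IsWeakSolution b f w ↔ (diffusion hc h).form 1 b w = riesz f := by
    constructor
    · intro hw
      refine ext_inner_right ℝ fun v => ?_
      rw [inner_diffusion_form, hw v, riesz, InnerProductSpace.toDual_symm_apply]
    · intro hw v
      rw [← inner_diffusion_form hc h, hw, riesz, InnerProductSpace.toDual_symm_apply]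
  rw [h1]
  constructor
  · intro hw
    rw [← hw, LogAffineFamily.solve_form]
  · rintro rfl
    exact LogAffineFamily.form_solve _ _ _

theorem solutionMap_eq {ψ : ℕ → LInf D} {y : ℕ → ℝ} {b : LInf D} (hb : IsLogCoeff ψ y b)
    (f : HNeg1 D) : solutionMap ψ f y = (diffusion hc h).solve b (riesz f) := by
  have hex : ∃ w : H10 D, ∃ b : LInf D, IsLogCoeff ψ y b ∧ IsWeakSolution b f w :=
    ⟨_, b, hb, (isWeakSolution_iff hc h b f _).2 rfl⟩
  rw [solutionMap, dif_pos hex]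
  obtain ⟨b', hb', hw⟩ := hex.choose_spec
  rw [tendsto_nhds_unique hb hb']
  exact (isWeakSolution_iff hc h b' f _).1 hw

theorem isLogCoeff_logCoeff {ψ : ℕ → LInf D} {y : ℕ → ℝ}
    (hy : Summable fun j => |y j| * ‖ψ j‖) :
    IsLogCoeff ψ y (LogAffineFamily.logCoeff ψ y) :=
  (LogAffineFamily.hasSum_logCoeff hy).tendsto_sum_nat

theorem solutionMap_ae_eq {ψ : ℕ → LInf D} (hs : Summable fun j => ‖ψ j‖) (f : HNeg1 D) :
    solutionMap ψ f =ᵐ[gaussianMeasure] fun y =>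
      (diffusion hc h).solve (LogAffineFamily.logCoeff ψ y) (riesz f) := by
  filter_upwards [ae_summable_abs_mul (fun j => norm_nonneg _) hs] with y hy
  exact solutionMap_eq hc h (isLogCoeff_logCoeff hy) f

end Diffusion

theorem normV_le_norm (v : H10 D) : normV v ≤ ‖v‖ := by
  have := WithLp.prod_norm_sq_eq_of_L2 (v : Pairs D)
  refine (sq_le_sq₀ (norm_nonneg _) (norm_nonneg _)).1 ?_
  change ‖(v : Pairs D).snd‖ ^ 2 ≤ ‖(v : Pairs D)‖ ^ 2
  rw [this]
  exact le_add_of_nonneg_left (sq_nonneg _)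

theorem summable_norm_of_summable_rpow {E : Type*} [NormedAddCommGroup E] {ψ : ℕ → E} {q : ℝ}
    (hq0 : 0 < q) (hq1 : q ≤ 1) (h : Summable fun j => ‖ψ j‖ ^ q) : Summable fun j => ‖ψ j‖ := by
  have h0 : ∀ j, 0 ≤ ‖ψ j‖ := fun j => norm_nonneg _
  have ht := tendsto_cofinite_zero_of_summable_rpow hq0 h0 h
  refine Summable.of_norm_bounded_eventually h ?_
  filter_upwards [ht.eventually (ge_mem_nhds zero_lt_one)] with j hj
  rw [norm_norm]
  simpa using Real.rpow_le_rpow_of_exponent_ge' (h0 j) hj hq0.le hq1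

end LognormalPDE

open LognormalPDE in
theorem corollary6p3 {d : ℕ} (hd : 0 < d) (D : Set (EuclideanSpace ℝ (Fin d)))
    (hDo : IsOpen D) (hDb : Bornology.IsBounded D)
    (f : LognormalPDE.HNeg1 D) (ψ : ℕ → LognormalPDE.LInf D)
    (p q : ℝ) (hp0 : 0 < p) (hp2 : p < 2) (hq : 1 / q = 1 / p + 1 / 2) :
    ((Summable fun j : ℕ => ‖ψ j‖ ^ q) →
      -- the solution map is almost everywhere well defined and lies in `L²(U, V, γ)`
      (∀ᵐ y ∂LognormalPDE.gaussianMeasure, ∃ b : LognormalPDE.LInf D,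
        LognormalPDE.IsLogCoeff ψ y b ∧
        LognormalPDE.IsWeakSolution b f (LognormalPDE.solutionMap ψ f y) ∧
        ∀ w, LognormalPDE.IsWeakSolution b f w → w = LognormalPDE.solutionMap ψ f y) ∧
      MemLp (LognormalPDE.solutionMap ψ f) 2 LognormalPDE.gaussianMeasure ∧
      -- `ℓ^p` summability of the Hermite coefficients
      (Summable fun ν : ℕ →₀ ℕ =>
        LognormalPDE.normV
          (LognormalPDE.hermiteCoeff (LognormalPDE.solutionMap ψ f) ν) ^ p) ∧
      -- convergence of best `n`-term truncations with rate `s = 1/q - 1`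
      ∀ n : ℕ,
        (∃ Λ, LognormalPDE.IsNLargest (LognormalPDE.solutionMap ψ f) n Λ) ∧
        ∀ Λ, LognormalPDE.IsNLargest (LognormalPDE.solutionMap ψ f) n Λ →
          LognormalPDE.normL2V (fun y => LognormalPDE.solutionMap ψ f y -
              LognormalPDE.hermiteTrunc (LognormalPDE.solutionMap ψ f) Λ y) ≤
            ENNReal.ofReal
              ((∑' ν : ℕ →₀ ℕ, LognormalPDE.normV
                  (LognormalPDE.hermiteCoeff (LognormalPDE.solutionMap ψ f) ν) ^ p) ^ (1 / p) *
                ((n : ℝ) + 1) ^ (-(1 / q - 1)))) ∧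
    -- the hypothesis is implied by the weighted condition for every exponent `β > 1/2`
    (∀ β : ℝ, 1 / 2 < β → (Summable fun j : ℕ => (((j : ℝ) + 1) ^ β * ‖ψ j‖) ^ p) →
      Summable fun j : ℕ => ‖ψ j‖ ^ q) := by
  refine ⟨fun hψ => ?_, fun β hβ h =>
    summable_rpow_of_weighted (fun j => norm_nonneg _) hp0 hq hβ h⟩
  have hq' : q = 2 * p / (2 + p) := by
    have : q = 1 / (1 / q) := by simp
    rw [this, hq]; field_simp
  have hq0 : 0 < q := by rw [hq']; positivity
  have hq1 : q ≤ 1 := by rw [hq', div_le_one (by positivity)]; linarith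
  have hs : Summable fun j => ‖ψ j‖ := summable_norm_of_summable_rpow hq0 hq1 hψ
  obtain ⟨c, hc, hPoin⟩ := exists_norm_le_norm_grad hd hDb
  set P := diffusion hc hPoin with hP
  have hae := solutionMap_ae_eq hc hPoin hs f
  have hmem : MemLp (solutionMap ψ f) 2 gaussianMeasure :=
    (memLp_congr_ae hae).2 (P.memLp_word (riesz f) hs (l := []) (by simp))
  have hgmem : MemLp (fun y => grad (solutionMap ψ f y)) 2 gaussianMeasure :=
    (gradL D).comp_memLp' hmem
  have hui : ∀ ν, Integrable (fun y => hermiteF ν y • solutionMap ψ f y) gaussianMeasure :=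
    fun ν => memLp_one_iff_integrable.1 (hmem.smul (memLp_hermiteF ν))
  set u : (ℕ →₀ ℕ) → ℝ := fun ν => normV (hermiteCoeff (solutionMap ψ f) ν) with hu
  have hu0 : ∀ ν, 0 ≤ u ν := fun ν => norm_nonneg _
  have hsum : Summable fun ν => u ν ^ p := by
    obtain ⟨r, hr⟩ := exists_summable_coeffBound (fun j => norm_nonneg (ψ j)) hp0 hp2 hq hψ
    refine Summable.of_nonneg_of_le (fun ν => Real.rpow_nonneg (hu0 ν) _) (fun ν => ?_)
      (hr.mul_left (P.majorantNorm (riesz f) ψ ^ p))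
    have hcb := coeffBound_nonneg r (fun j => norm_nonneg (ψ j)) ν
    have hmj : 0 ≤ P.majorantNorm (riesz f) ψ := Real.sqrt_nonneg _
    rw [← Real.mul_rpow hmj hcb]
    refine Real.rpow_le_rpow (hu0 ν) ?_ hp0.le
    refine (normV_le_norm _).trans ?_
    have h1 : hermiteCoeff (solutionMap ψ f) ν = ∫ y, hermiteF ν y •
        P.solve (LogAffineFamily.logCoeff ψ y) (riesz f) ∂gaussianMeasure := by
      refine integral_congr_ae ?_
      filter_upwards [hae] with y hy
      rw [hy]
    rw [h1]
    exact P.norm_integral_hermiteF_smul_solve_le (riesz f) hs r ν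
  refine ⟨?_, hmem, hsum, fun n => ⟨?_, fun Λ hΛ => ?_⟩⟩
  · filter_upwards [ae_summable_abs_mul (fun j => norm_nonneg (ψ j)) hs] with y hy
    have hb := isLogCoeff_logCoeff hy
    have hsol := solutionMap_eq hc hPoin hb f
    refine ⟨_, hb, (isWeakSolution_iff hc hPoin _ f _).2 hsol, fun w hw => ?_⟩
    rw [hsol]
    exact (isWeakSolution_iff hc hPoin _ f w).1 hw
  · exact exists_finset_card_eq_largest hu0
      (tendsto_cofinite_zero_of_summable_rpow hp0 hu0 hsum) n
  · have hcoeff : ∀ ν, grad (hermiteCoeff (solutionMap ψ f) ν) =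
        ∫ y, hermiteF ν y • grad (solutionMap ψ f y) ∂gaussianMeasure := by
      intro ν
      rw [← gradL_apply, hermiteCoeff, ← (gradL D).integral_comp_comm (hui ν)]
      simp [gradL_apply]
    have hres := hasSum_norm_sq_hermite_residual hgmem Λ
    simp_rw [← hcoeff] at hres
    set w : (ℕ → ℝ) → Lp (EuclideanSpace ℝ (Fin d)) 2 (vol D) := fun y =>
      grad (solutionMap ψ f y) - ∑ ν ∈ Λ, hermiteF ν y • grad (hermiteCoeff (solutionMap ψ f) ν)
      with hw
    have hwmem : MemLp w 2 gaussianMeasure :=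
      hgmem.sub (memLp_finsetSum Λ fun ν _ => memLp_hermiteF_smul ν _)
    have hnorm : normL2V (fun y => solutionMap ψ f y - hermiteTrunc (solutionMap ψ f) Λ y) =
        eLpNorm w 2 gaussianMeasure := by
      rw [normL2V, ← eLpNorm_norm w]
      congr 1
      ext y
      rw [normV, ← gradL_apply, map_sub, hermiteTrunc, map_sum, hw]
      simp [gradL_apply]
    have hrate : -(1 / q - 1) = -(1 / p - 1 / 2) := by rw [hq]; ring
    rw [hnorm, ← ENNReal.ofReal_toReal hwmem.2.ne, hrate]
    refine ENNReal.ofReal_le_ofReal ?_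
    exact tsum_sq_le_of_largest hp0 hp2 hu0 hsum hΛ.1 hΛ.2 hres ENNReal.toReal_nonneg
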